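/- Let $d\in\{2,3\}$, $k\ge 1$, $\sigma>0$. Let $\Omega\subset\mathbb R^d$ be a bounded connected polygonal (polyhedral) domain with $\Omega=\operatorname{int}\overline\Omega$, and let $M\subset\mathbb R^d$ be a compact $C^1$ hypersurface without boundary. Then there is a constant $C>0$, depending only on $d$, $k$, $\sigma$, $\Omega$ and $M$, such that the following holds. Let $\Omega_1,\Omega_2\subset\Omega$ be disjoint open sets with interface $\Gamma:=\overline\Omega_1\cap\overline\Omega_2$ such that $\Omega_1\cup\Omega_2=\Omega\setminus\Gamma$, and suppose that, for some Euclidean isometry $g$ of $\mathbb R^d$, $\Gamma\subset g(M)$ and $g(M)\cap\Omega\subset\Gamma$ (in particular, $\Gamma=g(M)$ is allowed if $g(M)\subset\Omega$). Let $\mathcal T_h$ be any conforming triangulation of $\Omega$ into finitely many closed simplices that is shape regular with parameter $\sigma$, i.e., every $T\in\mathcal T_h$ with diameter $h_T$ contains a ball of some radius $\rho_T>0$ with $h_T\le\sigma\rho_T$ (no quasi-uniformity is assumed). Let $\mathcal T_h^\Gamma:=\{T\in\mathcal T_h : T\cap\Gamma\ne\emptyset\}$ be the set of cut elements, $\Omega_h^\Gamma:=\bigcup_{T\in\mathcal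 T_h^\Gamma}T$, and let $V_h$ be the space of continuous functions on $\overline\Omega$ that are polynomials of degree at most $k$ on each $T\in\mathcal T_h$ and vanish on $\partial\Omega$. Then for all $v_h\in V_h(\Omega_h^\Gamma):=\{v|_{\Omega_h^\Gamma} : v\in V_h\}$, $$C^{-1}\,\|h^{-1}v_h\|_{\Omega_h^\Gamma}^2\;\le\;\|h^{-1/2}v_h\|_{\Gamma}^2+\|\nabla v_h\|_{\Omega_h^\Gamma}^2\;\le\; C\,\|h^{-1}v_h\|_{\Omega_h^\Gamma}^2,$$ where $\|h^{-1}v\|_{\Omega_h^\Gamma}^2:=\sum_{T\in\mathcal T_h^\Gamma}h_T^{-2}\|v\|_{L^2(T)}^2$, $\|h^{-1/2}v\|_\Gamma^2:=\sum_{T\in\mathcal T_h^\Gamma}h_T^{-1}\|v\|_{L^2(T\cap\Gamma)}^2$ (with respect to the surface measure) and $\|\nabla v\|_{\Omega_h^\Gamma}$ is the $L^2$-norm of the gradient on $\Omega_h^\Gamma$. In particular $C$ is independent of the mesh sizes, of the position of $\Gamma$ relative to the triangulation, and of the size of the sets $T\cap\Gamma$. -/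

import Mathlib

open scoped MeasureTheory

namespace CutFEM

/-- `ℝ^d` with the Euclidean norm. -/
abbrev Pt (d : ℕ) := EuclideanSpace ℝ (Fin d)

/-- The closed simplex spanned by a finite set of vertices. -/
def simplex {d : ℕ} (s : Finset (Pt d)) : Set (Pt d) := convexHull ℝ (s : Set (Pt d))

/-- A bounded connected polygonal (`d = 2`) or polyhedral (`d = 3`) domain: an open connected set
whose closure is a finite union of nondegenerate closed `d`-simplices and which lies on only one
side of its boundary (it is the interior of its closure). Boundedness is a consequence. -/
structure IsPolygonalDomain {d : ℕ} (Ω : Set (Pt d)) : Prop where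
  isOpen : IsOpen Ω
  isConnected : IsConnected Ω
  interior_closure : interior (closure Ω) = Ω
  polygonal : ∃ S : Finset (Finset (Pt d)),
    (∀ s ∈ S, s.card = d + 1 ∧ AffineIndependent ℝ ((↑) : s → Pt d)) ∧
      closure Ω = ⋃ s ∈ S, simplex s

/-- A compact `C¹` hypersurface (without boundary) in `ℝ^d`: a compact set that near each of its
points is the zero level of a `C¹` function with nonvanishing derivative at that point. -/
structure IsCompactC1Hypersurface {d : ℕ} (M : Set (Pt d)) : Prop where
  isCompact : IsCompact M
  isLevelSet : ∀ x ∈ M, ∃ (U : Set (Pt d)) (φ : Pt d → ℝ), IsOpen U ∧ x ∈ U ∧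
    ContDiffOn ℝ 1 φ U ∧ fderiv ℝ φ x ≠ 0 ∧ M ∩ U = {y ∈ U | φ y = 0}

/-- The interface between two subdomains. -/
def interface {d : ℕ} (Ω₁ Ω₂ : Set (Pt d)) : Set (Pt d) := closure Ω₁ ∩ closure Ω₂

/-- A non-overlapping partitioning of `Ω` into two open subdomains, separated by the interface. -/
structure IsPartition {d : ℕ} (Ω Ω₁ Ω₂ : Set (Pt d)) : Prop where
  isOpen_left : IsOpen Ω₁
  isOpen_right : IsOpen Ω₂
  disjoint : Disjoint Ω₁ Ω₂
  union_eq : Ω₁ ∪ Ω₂ = Ω \ interface Ω₁ Ω₂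

/-- A (conforming) simplicial triangulation of `Ω`: a finite simplicial complex with underlying
space `closure Ω` in which every face belongs to a `d`-simplex. -/
structure Triangulation {d : ℕ} (Ω : Set (Pt d)) where
  complex : Geometry.SimplicialComplex ℝ (Pt d)
  finite : complex.faces.Finite
  pure : ∀ s ∈ complex.faces, ∃ t ∈ complex.faces, s ⊆ t ∧ t.card = d + 1
  space_eq : complex.space = closure Ω

/-- The size `h_T`: the diameter of the simplex with the given vertices. -/
noncomputable def meshSize {d : ℕ} (T : Finset (Pt d)) : ℝ := Metric.diam (simplex T)

namespace Triangulation

variable {d : ℕ} {Ω : Set (Pt d)}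

/-- The elements of the triangulation, i.e. the (vertex sets of the) `d`-simplices. -/
noncomputable def elements (𝒯 : Triangulation Ω) : Finset (Finset (Pt d)) :=
  𝒯.finite.toFinset.filter fun T => T.card = d + 1

/-- Shape regularity with parameter `σ`: each element `T` contains a closed ball of some radius
`ρ > 0` with `h_T ≤ σ ρ`. -/
def IsShapeRegular (𝒯 : Triangulation Ω) (σ : ℝ) : Prop :=
  ∀ T ∈ 𝒯.elements, ∃ (z : Pt d) (ρ : ℝ), 0 < ρ ∧ Metric.closedBall z ρ ⊆ simplex T ∧
    meshSize T ≤ σ * ρ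

open scoped Classical in
/-- The elements that are cut by `Γ`: the closed simplex has a common point with `Γ`. -/
noncomputable def cutElements (𝒯 : Triangulation Ω) (Γ : Set (Pt d)) : Finset (Finset (Pt d)) :=
  𝒯.elements.filter fun T => (simplex T ∩ Γ).Nonempty

/-- The strip formed by all cut elements. -/
def strip (𝒯 : Triangulation Ω) (Γ : Set (Pt d)) : Set (Pt d) :=
  ⋃ T ∈ 𝒯.cutElements Γ, simplex T

/-- `v` coincides on the simplex `T` with a polynomial of total degree at most `k`. -/
def IsPolynomialOn (k : ℕ) (v : Pt d → ℝ) (T : Finset (Pt d)) : Prop :=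
  ∃ p : MvPolynomial (Fin d) ℝ, p.totalDegree ≤ k ∧
    ∀ x ∈ simplex T, v x = MvPolynomial.eval (fun i => x i) p

/-- The finite element space `V_h^k`: continuous functions on `closure Ω` that are piecewise
polynomial of degree at most `k` and vanish on `∂Ω`. The values outside `closure Ω` are
irrelevant. -/
def feSpace (𝒯 : Triangulation Ω) (k : ℕ) : Submodule ℝ (Pt d → ℝ) where
  carrier := {v | ContinuousOn v (closure Ω) ∧ (∀ T ∈ 𝒯.elements, IsPolynomialOn k v T) ∧
    ∀ x ∈ frontier Ω, v x = 0}
  zero_mem' := ⟨continuousOn_const, fun _ _ => ⟨0, by simp, by simp⟩, by simp⟩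
  add_mem' := by
    rintro v w ⟨hv, hv', hv0⟩ ⟨hw, hw', hw0⟩
    refine ⟨hv.add hw, fun T hT => ?_, fun x hx => by simp [hv0 x hx, hw0 x hx]⟩
    obtain ⟨p, hp, hpv⟩ := hv' T hT
    obtain ⟨q, hq, hqw⟩ := hw' T hT
    exact ⟨p + q, (MvPolynomial.totalDegree_add p q).trans (max_le hp hq),
      fun x hx => by simp [hpv x hx, hqw x hx]⟩
  smul_mem' := by
    rintro c v ⟨hv, hv', hv0⟩
    refine ⟨hv.const_smul c, fun T hT => ?_, fun x hx => by simp [hv0 x hx]⟩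
    obtain ⟨p, hp, hpv⟩ := hv' T hT
    exact ⟨c • p, (MvPolynomial.totalDegree_smul_le c p).trans hp,
      fun x hx => by simp [hpv x hx, MvPolynomial.smul_eval]⟩

/-- `‖h⁻¹ v‖²` on the strip, with element-wise scaling:
`∑_T h_T⁻² ∫_T v²` over the cut elements `T`. -/
noncomputable def scaledStripNormSq (𝒯 : Triangulation Ω) (Γ : Set (Pt d)) (v : Pt d → ℝ) : ℝ :=
  ∑ T ∈ 𝒯.cutElements Γ, (meshSize T ^ 2)⁻¹ * ∫ x in simplex T, v x ^ 2

/-- `‖h^{-1/2} v‖²` on `Γ`, with element-wise scaling: `∑_T h_T⁻¹ ∫_{T ∩ Γ} v²` over the cut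
elements `T`, with respect to the `(d-1)`-dimensional surface measure. -/
noncomputable def scaledInterfaceNormSq (𝒯 : Triangulation Ω) (Γ : Set (Pt d))
    (v : Pt d → ℝ) : ℝ :=
  ∑ T ∈ 𝒯.cutElements Γ, (meshSize T)⁻¹ * ∫ x in simplex T ∩ Γ, v x ^ 2 ∂μHE[d - 1]

/-- `‖∇ v‖²` on the strip. A finite element function is differentiable in the interior of each
element, and the remaining points form a null set. -/
noncomputable def gradStripNormSq (𝒯 : Triangulation Ω) (Γ : Set (Pt d)) (v : Pt d → ℝ) : ℝ :=
  ∫ x in 𝒯.strip Γ, ‖gradient v x‖ ^ 2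

end Triangulation

end CutFEM

/-! The upper bound is local. On a cut element `T` of size `h`, scaling to a ball gives the inverse
inequality `‖∇v‖² ≤ C h⁻² ‖v‖²` and the pointwise bound `v² ≤ C h^(-d) ‖v‖²`
(`exists_element_estimates`). The piece of the surface inside `T` has area at most `C h^(d-1)`
(`exists_measure_inter_closedBall_le`).

For the lower bound, take `x ∈ T ∩ Γ`. A Poincaré inequality bounds `h⁻² ‖v‖²` on `T` by `h^(d-2)
v(x)²` and `‖∇v‖²` (`scaled_norm_sq_le`), so it remains to control `v(x)`. The intersection `T ∩ Γ`
itself may be tiny, so one moves along the interface instead (`exists_local_estimate`). A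
bilipschitz chart of the surface at `x`, of radius `r` comparable with `h`, yields rays starting at
`x`. While such a ray is in `Ω` it lies in `Γ`, so it only meets cut elements. Being short, it also
stays among elements touching `T` (`exists_mem_patch_of_path`). There `v` varies by at most `C r
(h^(-d) ∑ ‖∇v‖²)^(1/2)`. Two cases remain. If some ray leaves `Ω`, then `v` vanishes at the exit
point and the variation alone bounds `v(x)`. Otherwise the whole chart image lies in `Γ`; it has
area at least `c h^(d-1)`, and integrating `v²` over it bounds `v(x)`. Each element occurs in
boundedly many of these neighbourhoods, so the local estimates can be summed.

Without quasi-uniformity, the sizes of the elements along a ray must be compared. Elements with a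
common edge have comparable sizes, and around a vertex inside `Ω` the elements are linked through
common edges because small spheres are connected when `d ≥ 2` (`meshSize_le_of_common_point`). At a
boundary vertex this linking may fail. The patch of `T` therefore only contains elements reached
through common points in the open set `Ω`, which is all that a path in `Ω` needs. -/

namespace CutFEM

open MeasureTheory Metric

/-! ### Polynomials of bounded degree: scaled norm equivalences on balls. -/

section Polynomials

variable {d : ℕ}

/-- The function on `ℝ^d` defined by a polynomial. -/
noncomputable def polyFun (p : MvPolynomial (Fin d) ℝ) (x : Pt d) : ℝ :=
  MvPolynomial.eval (fun i => x i) p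

/-- The gradient of the function defined by a polynomial. -/
noncomputable def polyGrad (p : MvPolynomial (Fin d) ℝ) (x : Pt d) : Pt d :=
  WithLp.toLp 2 fun i => polyFun (MvPolynomial.pderiv i p) x

theorem continuous_polyFun (p : MvPolynomial (Fin d) ℝ) : Continuous (polyFun p) :=
  (MvPolynomial.continuous_eval p).comp (by fun_prop)

theorem continuous_polyGrad (p : MvPolynomial (Fin d) ℝ) : Continuous (polyGrad p) :=
  (PiLp.continuous_toLp 2 _).comp (continuous_pi fun _ => continuous_polyFun _)

theorem norm_polyGrad_sq (p : MvPolynomial (Fin d) ℝ) (x : Pt d) :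
    ‖polyGrad p x‖ ^ 2 = ∑ i, polyFun (MvPolynomial.pderiv i p) x ^ 2 := by
  simp [polyGrad, EuclideanSpace.norm_sq_eq]

theorem hasGradientAt_polyFun (p : MvPolynomial (Fin d) ℝ) (x : Pt d) :
    HasGradientAt (polyFun p) (polyGrad p x) x := by
  rw [hasGradientAt_iff_hasFDerivAt]
  induction p using MvPolynomial.induction_on with
  | C a =>
    have : polyFun (MvPolynomial.C a : MvPolynomial (Fin d) ℝ) = fun _ => a := by
      ext; simp [polyFun]
    rw [this]
    have h0 : polyGrad (MvPolynomial.C a : MvPolynomial (Fin d) ℝ) x = 0 := by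
      ext i; simp [polyGrad, polyFun]
    rw [h0, map_zero]
    exact hasFDerivAt_const a x
  | add p q hp hq =>
    have : polyFun (p + q) = polyFun p + polyFun q := by ext; simp [polyFun]
    rw [this]
    have h0 : polyGrad (p + q) x = polyGrad p x + polyGrad q x := by
      ext i; simp [polyGrad, polyFun]
    rw [h0, map_add]
    exact hp.add hq
  | mul_X p i hp =>
    have : polyFun (p * MvPolynomial.X i) = fun y => polyFun p y * y i := by
      ext; simp [polyFun]
    rw [this]
    refine (hp.mul (EuclideanSpace.proj i : Pt d →L[ℝ] ℝ).hasFDerivAt).congr_fderiv ?_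
    ext y
    have key : ∀ w : Pt d, inner ℝ w y = ∑ j, y j * w j := fun w => by
      simp [PiLp.inner_apply]
    simp only [add_apply, smul_apply,
      InnerProductSpace.toDual_apply_apply, key, smul_eq_mul]
    have hpr : ∀ u : Pt d, (EuclideanSpace.proj i : Pt d →L[ℝ] ℝ) u = u i := fun _ => rfl
    simp only [hpr, polyGrad, polyFun, Derivation.leibniz, MvPolynomial.pderiv_X, smul_eq_mul, map_add,
      map_mul, MvPolynomial.eval_X, mul_add, Finset.sum_add_distrib, Finset.mul_sum]
    congr 1
    · rw [Finset.sum_eq_single i]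
      · simp; ring
      · intro j _ hj; simp [hj.symm]
      · simp
    · exact Finset.sum_congr rfl fun j _ => by ring

theorem totalDegree_pderiv_le (i : Fin d) (p : MvPolynomial (Fin d) ℝ) :
    (MvPolynomial.pderiv i p).totalDegree ≤ p.totalDegree := by
  conv_lhs => rw [p.as_sum, map_sum]
  refine MvPolynomial.totalDegree_finsetSum_le fun m hm => ?_
  rw [MvPolynomial.pderiv_monomial]
  refine (MvPolynomial.totalDegree_monomial_le _ _).trans (le_trans ?_ (MvPolynomial.le_totalDegree hm))
  have h : m - Finsupp.single i 1 ≤ m := tsub_le_self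
  exact Finsupp.degree_mono h

/-- A polynomial of the rescaled variable is a polynomial of the same degree. -/
theorem exists_polyFun_comp_homothety (p : MvPolynomial (Fin d) ℝ) (z : Pt d) (ρ : ℝ) :
    ∃ q : MvPolynomial (Fin d) ℝ, q.totalDegree ≤ p.totalDegree ∧
      ∀ y, polyFun q y = polyFun p (z + ρ • y) := by
  set f : Fin d → MvPolynomial (Fin d) ℝ :=
    fun i => MvPolynomial.C (z i) + MvPolynomial.C ρ * MvPolynomial.X i with hf
  have hdeg : ∀ i, (f i).totalDegree ≤ 1 := fun i => by
    refine (MvPolynomial.totalDegree_add _ _).trans (max_le (by simp) ?_)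
    refine (MvPolynomial.totalDegree_mul _ _).trans ?_
    simp [MvPolynomial.totalDegree_X]
  refine ⟨MvPolynomial.aeval f p, ?_, fun y => ?_⟩
  · conv_lhs => rw [p.as_sum, map_sum]
    refine MvPolynomial.totalDegree_finsetSum_le fun m hm => ?_
    refine le_trans ?_ (MvPolynomial.le_totalDegree hm)
    rw [MvPolynomial.aeval_monomial]
    refine (MvPolynomial.totalDegree_mul _ _).trans ?_
    rw [MvPolynomial.algebraMap_eq, MvPolynomial.totalDegree_C, zero_add]
    refine (MvPolynomial.totalDegree_finsetProd _ _).trans ?_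
    refine Finset.sum_le_sum fun i _ => ?_
    refine (MvPolynomial.totalDegree_pow _ _).trans ?_
    simpa using Nat.mul_le_mul_left (m i) (hdeg i)
  · simp only [polyFun]
    rw [← MvPolynomial.coe_aeval_eq_eval, ← MvPolynomial.coe_aeval_eq_eval]
    simp only [RingHom.coe_coe]
    rw [← AlgHom.comp_apply, MvPolynomial.comp_aeval]
    congr 2
    ext i
    simp [hf]

theorem polyGrad_of_comp_homothety {p q : MvPolynomial (Fin d) ℝ} {z : Pt d} {ρ : ℝ}
    (h : ∀ y, polyFun q y = polyFun p (z + ρ • y)) (y : Pt d) :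
    polyGrad q y = ρ • polyGrad p (z + ρ • y) := by
  have h1 := hasGradientAt_polyFun q y
  refine h1.unique ?_
  rw [hasGradientAt_iff_hasFDerivAt]
  have h2 := (hasGradientAt_polyFun p (z + ρ • y)).hasFDerivAt
  have h3 : HasFDerivAt (fun y : Pt d => z + ρ • y) (ρ • ContinuousLinearMap.id ℝ (Pt d)) y :=
    ((hasFDerivAt_id y).const_smul ρ).const_add z
  have h4 := h2.comp y h3
  have : polyFun q = polyFun p ∘ fun y => z + ρ • y := funext h
  rw [this]
  refine h4.congr_fderiv ?_
  ext w
  simp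

theorem integrableOn_closedBall_of_continuous {f : Pt d → ℝ} (hf : Continuous f) (z : Pt d)
    (r : ℝ) : IntegrableOn f (closedBall z r) :=
  hf.continuousOn.integrableOn_compact (isCompact_closedBall z r)

/-- A continuous function with vanishing square integral is zero on the open ball, and analyticity
spreads this to the whole space. This is the definiteness of the `L²` inner product used below. -/
theorem polynomial_eq_zero_of_setIntegral_sq_eq_zero {p : MvPolynomial (Fin d) ℝ}
    (h : ∫ x in closedBall (0 : Pt d) 1, polyFun p x * polyFun p x = 0) : p = 0 := by
  have hc := continuous_polyFun p
  rw [setIntegral_eq_zero_iff_of_nonneg_ae (Filter.Eventually.of_forall fun x => mul_self_nonneg _)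
    (integrableOn_closedBall_of_continuous (hc.mul hc) 0 1)] at h
  have h1 : (fun x => polyFun p x * polyFun p x) =ᵐ[volume.restrict (ball (0 : Pt d) 1)]
      fun _ => 0 := ae_restrict_of_ae_restrict_of_subset ball_subset_closedBall h
  have h2 : Set.EqOn (fun x => polyFun p x * polyFun p x) (fun _ => 0) (ball (0 : Pt d) 1) :=
    Measure.eqOn_open_of_ae_eq h1 isOpen_ball (hc.mul hc).continuousOn continuousOn_const
  have han : AnalyticOnNhd ℝ (fun x => MvPolynomial.eval x p) Set.univ :=
    AnalyticOnNhd.eval_mvPolynomial p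
  have h3 : (fun x : Fin d → ℝ => MvPolynomial.eval x p) = fun _ => 0 := by
    refine han.eq_of_eventuallyEq analyticOnNhd_const (z₀ := 0) ?_
    have hcont : Continuous fun x : Fin d → ℝ => (WithLp.toLp 2 x : Pt d) :=
      PiLp.continuous_toLp 2 _
    have : (fun x : Fin d → ℝ => (WithLp.toLp 2 x : Pt d)) ⁻¹' ball 0 1 ∈ nhds 0 :=
      (isOpen_ball.preimage hcont).mem_nhds (by simp)
    filter_upwards [this] with x hx
    have := h2 hx
    simpa [polyFun] using this
  exact MvPolynomial.funext fun x => by simpa using congrFun h3 x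

theorem exists_norm_sq_le_mul_inner {W F : Type*} [AddCommGroup W] [Module ℝ W]
    [FiniteDimensional ℝ W] [NormedAddCommGroup F] [NormedSpace ℝ F]
    (core : InnerProductSpace.Core ℝ W) (B : W →ₗ[ℝ] F) :
    ∃ C : ℝ, 0 ≤ C ∧ ∀ p, ‖B p‖ ^ 2 ≤ C * core.inner p p := by
  let : NormedAddCommGroup W := core.toNormedAddCommGroup
  let : InnerProductSpace ℝ W := InnerProductSpace.ofCore core.toCore
  refine ⟨‖LinearMap.toContinuousLinearMap B‖ ^ 2, by positivity, fun p => ?_⟩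
  have h1 := (LinearMap.toContinuousLinearMap B).le_opNorm p
  have h2 : core.inner p p = ‖p‖ ^ 2 := (real_inner_self_eq_norm_sq p)
  rw [h2, ← mul_pow]
  exact pow_le_pow_left₀ (norm_nonneg _) h1 2

/-- Polynomials of degree at most `k` form a finite-dimensional space, so the linear map `p ↦ D p`
into the continuous functions on the ball of radius `R` is bounded for the `L²` norm of the unit
ball. The operator `D` will be the identity or a partial derivative. -/
theorem exists_forall_sq_le_setIntegral_closedBall (k : ℕ) (R : ℝ)
    (D : MvPolynomial (Fin d) ℝ →ₗ[ℝ] MvPolynomial (Fin d) ℝ) :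
    ∃ C : ℝ, 0 ≤ C ∧ ∀ p : MvPolynomial (Fin d) ℝ, p.totalDegree ≤ k →
      ∀ y ∈ closedBall (0 : Pt d) R,
        polyFun (D p) y ^ 2 ≤ C * ∫ x in closedBall (0 : Pt d) 1, polyFun p x ^ 2 := by
  let W := MvPolynomial.restrictTotalDegree (Fin d) ℝ k
  have hint : ∀ p q : MvPolynomial (Fin d) ℝ,
      IntegrableOn (fun x => polyFun p x * polyFun q x) (closedBall (0 : Pt d) 1) := fun p q =>
    integrableOn_closedBall_of_continuous ((continuous_polyFun p).mul (continuous_polyFun q)) 0 1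
  let core : InnerProductSpace.Core ℝ W :=
    { inner := fun p q => ∫ x in closedBall (0 : Pt d) 1, polyFun p.1 x * polyFun q.1 x
      conj_inner_symm := fun p q => by simp [mul_comm]
      re_inner_nonneg := fun p => by
        simpa using integral_nonneg fun x => mul_self_nonneg (polyFun p.1 x)
      add_left := fun p q r => by
        rw [← integral_add (hint _ _) (hint _ _)]
        congr 1; ext x; simp [polyFun, add_mul]
      smul_left := fun p q r => by
        simp only [conj_trivial]
        rw [← integral_const_mul]
        congr 1; ext x; simp [polyFun, MvPolynomial.smul_eval, mul_assoc]
      definite := fun p hp => Subtype.ext (polynomial_eq_zero_of_setIntegral_sq_eq_zero hp) }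
  have : CompactSpace (closedBall (0 : Pt d) R) := isCompact_iff_compactSpace.1
    (isCompact_closedBall 0 R)
  let B : W →ₗ[ℝ] C(closedBall (0 : Pt d) R, ℝ) :=
    { toFun := fun p => ⟨fun y => polyFun (D p.1) y.1,
        (continuous_polyFun _).comp continuous_subtype_val⟩
      map_add' := fun p q => by ext y; simp [polyFun]
      map_smul' := fun r p => by ext y; simp [polyFun, MvPolynomial.smul_eval] }
  obtain ⟨C, hC, h⟩ := exists_norm_sq_le_mul_inner core B
  refine ⟨C, hC, fun p hp y hy => ?_⟩
  have h1 := h ⟨p, (MvPolynomial.mem_restrictTotalDegree _ _ _).2 hp⟩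
  have h2 : |polyFun (D p) y| ≤ ‖B ⟨p, (MvPolynomial.mem_restrictTotalDegree _ _ _).2 hp⟩‖ :=
    ContinuousMap.norm_coe_le_norm (B ⟨p, _⟩) ⟨y, hy⟩
  rw [← sq_abs]
  refine (pow_le_pow_left₀ (abs_nonneg _) h2 2).trans (h1.trans_eq ?_)
  simp only [pow_two]
  rfl

theorem setIntegral_closedBall_comp_homothety (f : Pt d → ℝ) (z : Pt d) {ρ : ℝ} (hρ : 0 < ρ) :
    ∫ x in closedBall (0 : Pt d) 1, f (z + ρ • x) = (ρ ^ d)⁻¹ * ∫ x in closedBall z ρ, f x := by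
  have h1 := Measure.setIntegral_comp_smul (volume : Measure (Pt d)) (fun x => f (z + x))
    (closedBall (0 : Pt d) 1) hρ.ne'
  rw [h1, finrank_euclideanSpace_fin, abs_of_pos (by positivity), smul_eq_mul]
  congr 1
  rw [smul_unitClosedBall, Real.norm_of_nonneg hρ.le]
  have h2 := (measurePreserving_add_left (volume : Measure (Pt d)) z).setIntegral_preimage_emb
    (MeasurableEquiv.addLeft z).measurableEmbedding f (closedBall z ρ)
  rw [← h2]
  congr 2
  ext x
  simp [dist_eq_norm]

/-- Scaled norm equivalences for polynomials on sets comparable with a ball. -/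
theorem exists_polynomial_estimates (d k : ℕ) (σ : ℝ) :
    ∃ C : ℝ, 0 ≤ C ∧ ∀ (p : MvPolynomial (Fin d) ℝ) (z : Pt d) (ρ : ℝ), p.totalDegree ≤ k → 0 < ρ →
      ∀ y ∈ closedBall z (σ * ρ),
        polyFun p y ^ 2 ≤ C * ((ρ ^ d)⁻¹ * ∫ x in closedBall z ρ, polyFun p x ^ 2) ∧
        ρ ^ 2 * ‖polyGrad p y‖ ^ 2 ≤ C * ((ρ ^ d)⁻¹ * ∫ x in closedBall z ρ, polyFun p x ^ 2) ∧
        ‖polyGrad p y‖ ^ 2 ≤ C * ((ρ ^ d)⁻¹ * ∫ x in closedBall z ρ, ‖polyGrad p x‖ ^ 2) := by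
  obtain ⟨C₀, hC₀, h₀⟩ := exists_forall_sq_le_setIntegral_closedBall (d := d) k σ LinearMap.id
  choose C₁ hC₁ h₁ using fun i : Fin d =>
    exists_forall_sq_le_setIntegral_closedBall (d := d) k σ (MvPolynomial.pderiv i).toLinearMap
  have main₀ : ∀ (p : MvPolynomial (Fin d) ℝ) (z : Pt d) (ρ : ℝ), p.totalDegree ≤ k → 0 < ρ →
      ∀ y ∈ closedBall z (σ * ρ),
        polyFun p y ^ 2 ≤ C₀ * ((ρ ^ d)⁻¹ * ∫ x in closedBall z ρ, polyFun p x ^ 2) ∧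
        ρ ^ 2 * ‖polyGrad p y‖ ^ 2 ≤
          (∑ i, C₁ i) * ((ρ ^ d)⁻¹ * ∫ x in closedBall z ρ, polyFun p x ^ 2) := by
    intro p z ρ hp hρ y hy
    obtain ⟨q, hq, hqp⟩ := exists_polyFun_comp_homothety p z ρ
    have hI : ∫ x in closedBall (0 : Pt d) 1, polyFun q x ^ 2 =
        (ρ ^ d)⁻¹ * ∫ x in closedBall z ρ, polyFun p x ^ 2 := by
      simp_rw [hqp]
      exact setIntegral_closedBall_comp_homothety (fun x => polyFun p x ^ 2) z hρ
    set w : Pt d := ρ⁻¹ • (y - z) with hw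
    have hyw : z + ρ • w = y := by
      rw [hw, smul_smul, mul_inv_cancel₀ hρ.ne', one_smul, add_sub_cancel]
    have hwmem : w ∈ closedBall (0 : Pt d) σ := by
      rw [mem_closedBall_zero_iff, hw, norm_smul, norm_inv, Real.norm_of_nonneg hρ.le,
        inv_mul_le_iff₀ hρ, mul_comm]
      simpa [dist_eq_norm] using hy
    rw [← hI]
    constructor
    · rw [← hyw, ← hqp]
      exact h₀ q (hq.trans hp) w hwmem
    · have h5 := polyGrad_of_comp_homothety hqp w
      rw [hyw] at h5
      have h6 : ρ ^ 2 * ‖polyGrad p y‖ ^ 2 = ‖polyGrad q w‖ ^ 2 := by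
        rw [h5, norm_smul, mul_pow, Real.norm_of_nonneg hρ.le]
      rw [h6, norm_polyGrad_sq, Finset.sum_mul]
      exact Finset.sum_le_sum fun i _ => h₁ i q (hq.trans hp) w hwmem
  have hnn : ∀ (z : Pt d) (ρ : ℝ) (f : Pt d → ℝ), 0 < ρ →
      0 ≤ (ρ ^ d)⁻¹ * ∫ x in closedBall z ρ, f x ^ 2 := fun z ρ f hρ =>
    mul_nonneg (by positivity) (integral_nonneg fun x => sq_nonneg _)
  have hs : 0 ≤ ∑ i, C₁ i := Finset.sum_nonneg fun i _ => hC₁ i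
  refine ⟨C₀ + ∑ i, C₁ i, by positivity, fun p z ρ hp hρ y hy => ⟨?_, ?_, ?_⟩⟩
  · exact (main₀ p z ρ hp hρ y hy).1.trans
      (mul_le_mul_of_nonneg_right (by linarith) (hnn z ρ _ hρ))
  · exact (main₀ p z ρ hp hρ y hy).2.trans
      (mul_le_mul_of_nonneg_right (by linarith) (hnn z ρ _ hρ))
  -- The partial derivatives are polynomials of degree at most `k`, so the first estimate applies to
  -- each of them.
  · simp_rw [norm_polyGrad_sq]
    have hint : ∀ i ∈ Finset.univ, IntegrableOn
        (fun x => polyFun (MvPolynomial.pderiv i p) x ^ 2) (closedBall z ρ) := fun i _ =>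
      integrableOn_closedBall_of_continuous ((continuous_polyFun _).pow 2) z ρ
    rw [integral_finsetSum _ hint]
    rw [Finset.mul_sum, Finset.mul_sum]
    refine Finset.sum_le_sum fun i _ => ?_
    exact (main₀ _ z ρ ((totalDegree_pderiv_le i p).trans hp) hρ y hy).1.trans
      (mul_le_mul_of_nonneg_right (by linarith) (hnn z ρ _ hρ))

end Polynomials

/-! ### Affine functions on simplices. -/

section Simplices

variable {d : ℕ}

theorem exists_affineMap_eq_on {T : Finset (Pt d)} (hT : AffineIndependent ℝ ((↑) : T → Pt d))
    (hcard : T.card = d + 1) (f : Pt d → ℝ) : ∃ A : Pt d →ᵃ[ℝ] ℝ, ∀ p ∈ T, A p = f p := by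
  have htop : affineSpan ℝ (Set.range ((↑) : T → Pt d)) = ⊤ := by
    rw [hT.affineSpan_eq_top_iff_card_eq_finrank_add_one]
    simp [hcard]
  let b : AffineBasis T ℝ (Pt d) := ⟨(↑), hT, htop⟩
  refine ⟨∑ q : T, f q • b.coord q, fun p hp => ?_⟩
  have h1 : ∀ q : T, b.coord q p = if q = ⟨p, hp⟩ then 1 else 0 := fun q => b.coord_apply q ⟨p, hp⟩
  have h2 : (∑ q : T, f q • b.coord q) p = ∑ q : T, f q * b.coord q p := by
    classical
    induction (Finset.univ : Finset T) using Finset.induction_on with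
    | empty => simp
    | insert a s ha ih => rw [Finset.sum_insert ha, Finset.sum_insert ha, ← ih]; rfl
  rw [h2]
  simp [h1]

/-- An affine function with values in `[0, 1]` on a ball of radius `ρ` has slope at most `1 / ρ`. -/
theorem abs_sub_le_of_mem_Icc_on_closedBall {A : Pt d →ᵃ[ℝ] ℝ} {z : Pt d} {ρ : ℝ} (hρ : 0 < ρ)
    (hA : ∀ y ∈ closedBall z ρ, A y ∈ Set.Icc (0 : ℝ) 1) (x y : Pt d) :
    |A x - A y| ≤ ρ⁻¹ * dist x y := by
  rcases eq_or_ne x y with rfl | hxy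
  · simp
  have hn : 0 < ‖x - y‖ := norm_pos_iff.2 (sub_ne_zero.2 hxy)
  -- The direction `x - y` rescaled to length `ρ`: both `z` and `w + z` lie in the ball, so `A`
  -- changes by at most `1` along `w`.
  set w : Pt d := (ρ / ‖x - y‖) • (x - y) with hw
  have hwn : ‖w‖ = ρ := by
    rw [hw, norm_smul, Real.norm_of_nonneg (by positivity), div_mul_cancel₀ _ hn.ne']
  have h1 := hA (w + z) (by simp [hwn])
  have h2 := hA z (by simp [hρ.le])
  have h3 : A (w + z) - A z = (ρ / ‖x - y‖) * (A x - A y) := by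
    have e1 : A (w + z) - A z = A.linear w := by
      have := A.map_vadd z w
      simp only [vadd_eq_add] at this
      rw [this]; ring
    have e2 : A x - A y = A.linear (x - y) := by
      simpa using (A.linearMap_vsub x y).symm
    rw [e1, e2, hw, map_smul, smul_eq_mul]
  have h4 : |(ρ / ‖x - y‖) * (A x - A y)| ≤ 1 := by
    rw [← h3, abs_le]
    constructor <;> linarith [h1.1, h1.2, h2.1, h2.2]
  rw [abs_mul, abs_of_pos (by positivity : 0 < ρ / ‖x - y‖)] at h4
  rw [dist_eq_norm, ← div_eq_inv_mul, le_div_iff₀ hρ]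
  rw [div_mul_eq_mul_div, div_le_one hn] at h4
  linarith

theorem isCompact_simplex (T : Finset (Pt d)) : IsCompact (simplex T) :=
  T.finite_toSet.isCompact_convexHull ℝ

theorem convex_simplex (T : Finset (Pt d)) : Convex ℝ (simplex T) := convex_convexHull ℝ _

theorem subset_simplex (T : Finset (Pt d)) : (T : Set (Pt d)) ⊆ simplex T := subset_convexHull ℝ _

theorem dist_le_meshSize {T : Finset (Pt d)} {x y : Pt d} (hx : x ∈ simplex T)
    (hy : y ∈ simplex T) : dist x y ≤ meshSize T :=
  dist_le_diam_of_mem (isCompact_simplex T).isBounded hx hy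

theorem affineMap_mem_Icc_on_simplex {T : Finset (Pt d)} {A : Pt d →ᵃ[ℝ] ℝ}
    (h : ∀ p ∈ T, A p ∈ Set.Icc (0 : ℝ) 1) : ∀ y ∈ simplex T, A y ∈ Set.Icc (0 : ℝ) 1 :=
  convexHull_min (t := A ⁻¹' Set.Icc 0 1) h ((convex_Icc 0 1).affine_preimage A)

theorem affineMap_eq_on_convexHull {S : Set (Pt d)} {A B : Pt d →ᵃ[ℝ] ℝ}
    (h : ∀ p ∈ S, A p = B p) : ∀ y ∈ convexHull ℝ S, A y = B y := by
  have : Convex ℝ {y | (A - B) y = 0} := (convex_singleton 0).affine_preimage (A - B)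
  intro y hy
  have h1 := convexHull_min (t := {y | (A - B) y = 0})
    (fun p hp => by simp [h p hp]) this hy
  simpa [sub_eq_zero] using h1

end Simplices

/-! ### Propagation of size bounds through a connected finite family. -/

section ChainBound

/-- If every proper subset of `F` containing `a` can be left with a jump of `h` by at most the
factor `κ`, then the values of `h` on `F` are controlled by the value at `a`. -/
theorem le_pow_card_mul_of_forall_subset {α : Type*} {F : Finset α} {h : α → ℝ}
    {κ : ℝ} (hκ : 1 ≤ κ) (hh : ∀ t, 0 ≤ h t) {a : α} (ha : a ∈ F)
    (hF : ∀ A ⊆ F, a ∈ A → A ≠ F → ∃ t ∈ A, ∃ t' ∈ F, t' ∉ A ∧ h t' ≤ κ * h t) :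
    ∀ b ∈ F, h b ≤ κ ^ F.card * h a := by
  classical
  have key : ∀ n : ℕ, ∃ A ⊆ F, a ∈ A ∧ (A = F ∨ n < A.card) ∧ ∀ t ∈ A, h t ≤ κ ^ n * h a := by
    intro n
    induction n with
    | zero => exact ⟨{a}, by simpa using ha, by simp, by simp, by simp⟩
    | succ n ih =>
      obtain ⟨A, hAF, haA, hn, hA⟩ := ih
      have hmono : κ ^ n * h a ≤ κ ^ (n + 1) * h a :=
        mul_le_mul_of_nonneg_right (pow_le_pow_right₀ hκ n.le_succ) (hh a)
      by_cases hAeq : A = F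
      · exact ⟨A, hAF, haA, Or.inl hAeq, fun t ht => (hA t ht).trans hmono⟩
      · obtain ⟨t, ht, t', ht', htA, hle⟩ := hF A hAF haA hAeq
        refine ⟨insert t' A, Finset.insert_subset ht' hAF, Finset.mem_insert_of_mem haA, Or.inr ?_,
          fun s hs => ?_⟩
        · rw [Finset.card_insert_of_notMem htA]
          have := hn.resolve_left hAeq
          omega
        · rcases Finset.mem_insert.1 hs with rfl | hs
          · refine hle.trans ?_
            rw [pow_succ', mul_assoc]
            exact mul_le_mul_of_nonneg_left (hA t ht) (by linarith)
          · exact (hA s hs).trans hmono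
  obtain ⟨A, hAF, -, hn, hA⟩ := key F.card
  have : A = F := hn.resolve_right fun h => absurd (Finset.card_le_card hAF) (by omega)
  exact this ▸ hA

end ChainBound

/-! ### Conformity and shape regularity of a triangulation. -/

namespace Triangulation

variable {d k : ℕ} {Ω : Set (Pt d)} {𝒯 : Triangulation Ω} {σ : ℝ}

theorem mem_elements {T : Finset (Pt d)} :
    T ∈ 𝒯.elements ↔ T ∈ 𝒯.complex.faces ∧ T.card = d + 1 := by
  simp [elements]

theorem affineIndependent {T : Finset (Pt d)} (hT : T ∈ 𝒯.elements) :
    AffineIndependent ℝ ((↑) : T → Pt d) := 𝒯.complex.indep (mem_elements.1 hT).1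

theorem closure_eq : closure Ω = ⋃ T ∈ 𝒯.elements, simplex T := by
  rw [← 𝒯.space_eq]
  apply subset_antisymm
  · intro x hx
    obtain ⟨s, hs, hxs⟩ := Geometry.SimplicialComplex.mem_space_iff.1 hx
    obtain ⟨t, ht, hst, hc⟩ := 𝒯.pure s hs
    exact Set.mem_biUnion (mem_elements.2 ⟨ht, hc⟩) (convexHull_mono (by exact_mod_cast hst) hxs)
  · exact Set.iUnion₂_subset fun T hT =>
      𝒯.complex.convexHull_subset_space (mem_elements.1 hT).1

theorem simplex_subset_closure {T : Finset (Pt d)} (hT : T ∈ 𝒯.elements) :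
    simplex T ⊆ closure Ω := by
  rw [closure_eq (𝒯 := 𝒯)]
  exact Set.subset_biUnion_of_mem (u := simplex) hT

theorem exists_mem_simplex {x : Pt d} (hx : x ∈ closure Ω) : ∃ T ∈ 𝒯.elements, x ∈ simplex T := by
  rw [closure_eq (𝒯 := 𝒯)] at hx
  simpa using hx

theorem simplex_inter_simplex {T T' : Finset (Pt d)} (hT : T ∈ 𝒯.elements)
    (hT' : T' ∈ 𝒯.elements) :
    simplex T ∩ simplex T' = convexHull ℝ ((T : Set (Pt d)) ∩ T') :=
  𝒯.complex.convexHull_inter_convexHull (mem_elements.1 hT).1 (mem_elements.1 hT').1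

theorem mem_of_mem_simplex {T T' : Finset (Pt d)} (hT : T ∈ 𝒯.elements) (hT' : T' ∈ 𝒯.elements)
    {p : Pt d} (hp : p ∈ T) (hpT' : p ∈ simplex T') : p ∈ T' := by
  have h : p ∈ 𝒯.complex.vertices := 𝒯.complex.down_closed (mem_elements.1 hT).1
    (by simpa using hp) (by simp)
  exact (𝒯.complex.vertex_mem_convexHull_iff h (mem_elements.1 hT').1).1 hpT'

/-- By conformity the intersection is spanned by the common vertices. Nonempty interior would force
`d + 1` of them, hence `T = T'`. -/
theorem disjoint_interior {T T' : Finset (Pt d)} (hT : T ∈ 𝒯.elements) (hT' : T' ∈ 𝒯.elements)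
    (hne : T ≠ T') : Disjoint (interior (simplex T)) (interior (simplex T')) := by
  classical
  rw [Set.disjoint_iff_inter_eq_empty, ← interior_inter, simplex_inter_simplex hT hT',
    ← Finset.coe_inter, ← Set.not_nonempty_iff_eq_empty,
    interior_convexHull_nonempty_iff_affineSpan_eq_top]
  intro htop
  have hsub : (Set.range ((↑) : (T ∩ T' : Finset (Pt d)) → Pt d)) =
      ((T ∩ T' : Finset _) : Set (Pt d)) := by
    ext; simp
  have hind : AffineIndependent ℝ ((↑) : (T ∩ T' : Finset (Pt d)) → Pt d) :=
    (affineIndependent hT).mono (by simp)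
  rw [← hsub, hind.affineSpan_eq_top_iff_card_eq_finrank_add_one] at htop
  simp only [Fintype.card_coe, finrank_euclideanSpace_fin] at htop
  have h1 : T ∩ T' = T := Finset.eq_of_subset_of_card_le Finset.inter_subset_left
    (by rw [htop, (mem_elements.1 hT).2])
  have h2 : T ∩ T' = T' := Finset.eq_of_subset_of_card_le Finset.inter_subset_right
    (by rw [htop, (mem_elements.1 hT').2])
  exact hne (h1.symm.trans h2)

theorem exists_ball (hd : 0 < d) (hσ : 𝒯.IsShapeRegular σ) {T : Finset (Pt d)}
    (hT : T ∈ 𝒯.elements) : ∃ (z : Pt d) (ρ : ℝ), 0 < ρ ∧ closedBall z ρ ⊆ simplex T ∧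
      simplex T ⊆ closedBall z (σ * ρ) ∧ ρ ≤ meshSize T ∧ meshSize T ≤ σ * ρ := by
  obtain ⟨z, ρ, hρ, hb, hm⟩ := hσ T hT
  have hz : z ∈ simplex T := hb (mem_closedBall_self hρ.le)
  refine ⟨z, ρ, hρ, hb, fun y hy => (dist_le_meshSize hy hz).trans hm, ?_, hm⟩
  -- A point of the ball at distance exactly `ρ` from its centre; this gives `ρ ≤ h_T`.
  have hy : z + EuclideanSpace.single ⟨0, hd⟩ ρ ∈ closedBall z ρ := by
    simp [abs_of_pos hρ]
  have := dist_le_meshSize (hb hy) hz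
  simpa [abs_of_pos hρ] using this

theorem meshSize_pos (hd : 0 < d) (hσ : 𝒯.IsShapeRegular σ) {T : Finset (Pt d)}
    (hT : T ∈ 𝒯.elements) : 0 < meshSize T := by
  obtain ⟨z, ρ, hρ, -, -, h, -⟩ := exists_ball hd hσ hT
  linarith

/-- Affine functions with vertex values in `[0, 1]` have slope at most `σ / h_T`. -/
theorem exists_interpolant (hd : 0 < d) (hσ : 𝒯.IsShapeRegular σ) {T : Finset (Pt d)}
    (hT : T ∈ 𝒯.elements) {f : Pt d → ℝ} (hf : ∀ p ∈ T, f p ∈ Set.Icc (0 : ℝ) 1) :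
    ∃ A : Pt d →ᵃ[ℝ] ℝ, (∀ p ∈ T, A p = f p) ∧
      ∀ x y, |A x - A y| ≤ σ / meshSize T * dist x y := by
  obtain ⟨A, hA⟩ := exists_affineMap_eq_on (affineIndependent hT) (mem_elements.1 hT).2 f
  obtain ⟨z, ρ, hρ, hb, -, hle, hm⟩ := exists_ball hd hσ hT
  refine ⟨A, hA, fun x y => ?_⟩
  have h1 := affineMap_mem_Icc_on_simplex (A := A) fun p hp => (hA p hp).symm ▸ hf p hp
  refine (abs_sub_le_of_mem_Icc_on_closedBall hρ (fun y hy => h1 y (hb hy)) x y).trans ?_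
  refine mul_le_mul_of_nonneg_right ?_ dist_nonneg
  rw [inv_eq_one_div, div_le_div_iff₀ hρ (meshSize_pos hd hσ hT)]
  linarith

/-- The nodal function of `p` drops from `1` to `0` along the edge from `p` to `q`, with slope at
most `σ / h_T`. Hence no edge is short compared with the element. -/
theorem meshSize_le_mul_dist (hd : 0 < d) (hσ : 𝒯.IsShapeRegular σ) {T : Finset (Pt d)}
    (hT : T ∈ 𝒯.elements) {p q : Pt d} (hp : p ∈ T) (hq : q ∈ T) (hpq : p ≠ q) :
    meshSize T ≤ σ * dist p q := by
  classical
  obtain ⟨A, hA, hL⟩ := exists_interpolant hd hσ hT (f := fun x => if x = p then 1 else 0)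
    (fun x _ => by split_ifs <;> simp)
  have h1 := hL p q
  rw [hA p hp, hA q hq, if_pos rfl, if_neg hpq.symm, sub_zero, abs_one, div_mul_eq_mul_div,
    le_div_iff₀ (meshSize_pos hd hσ hT)] at h1
  linarith

theorem meshSize_le_of_common_edge (hd : 0 < d) (hσ : 𝒯.IsShapeRegular σ) (hσ0 : 0 ≤ σ)
    {T T' : Finset (Pt d)}
    (hT : T ∈ 𝒯.elements) {p q : Pt d} (hp : p ∈ T) (hq : q ∈ T) (hp' : p ∈ T') (hq' : q ∈ T')
    (hpq : p ≠ q) : meshSize T ≤ σ * meshSize T' :=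
  (meshSize_le_mul_dist hd hσ hT hp hq hpq).trans
    (mul_le_mul_of_nonneg_left (dist_le_meshSize (subset_simplex _ hp') (subset_simplex _ hq')) hσ0)

/-! ### Elements around a vertex: their number and their relative sizes. -/

open scoped Classical in
/-- The elements with a given vertex. -/
noncomputable def star (𝒯 : Triangulation Ω) (p : Pt d) : Finset (Finset (Pt d)) :=
  𝒯.elements.filter fun T => p ∈ T

theorem mem_star {p : Pt d} {T : Finset (Pt d)} : T ∈ 𝒯.star p ↔ T ∈ 𝒯.elements ∧ p ∈ T := by
  simp [star]

/-- A bound for the number of elements with a common vertex. -/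
noncomputable def starBound (d : ℕ) (σ : ℝ) : ℕ := ⌊σ ^ d⌋₊

/-- Volume counting. Let `r` be the smallest size in the star. Shrinking each element towards `p` by
the factor `r / h_T` keeps it inside itself and inside the ball of radius `r` about `p`, and the
shrunken element still contains a ball of radius `r / σ`. These balls are disjoint, so there are at
most `σ ^ d` of them. -/
theorem card_star_le (hd : 0 < d) (hσ : 𝒯.IsShapeRegular σ) (hσ1 : 1 ≤ σ) (p : Pt d) :
    (𝒯.star p).card ≤ starBound d σ := by
  classical
  rw [starBound, Nat.le_floor_iff (by positivity)]
  have hσ0 : 0 < σ := by linarith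
  rcases (𝒯.star p).eq_empty_or_nonempty with he | hne
  · rw [he]; simp; positivity
  obtain ⟨T₀, hT₀, hmin⟩ := (𝒯.star p).exists_min_image meshSize hne
  set r := meshSize T₀ with hr
  have hr0 : 0 < r := meshSize_pos hd hσ (mem_star.1 hT₀).1
  have hball : ∀ T ∈ 𝒯.star p, ∃ c : Pt d, ball c (r / σ) ⊆ simplex T ∧
      ball c (r / σ) ⊆ closedBall p r := by
    intro T hT
    obtain ⟨hTe, hpT⟩ := mem_star.1 hT
    obtain ⟨z, ρ, hρ, hb, -, -, hm⟩ := exists_ball hd hσ hTe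
    have hh := meshSize_pos hd hσ hTe
    set s := r / meshSize T with hs
    have hs0 : 0 < s := by positivity
    have hs1 : s ≤ 1 := (div_le_one hh).2 (hmin T hT)
    have hpt : ∀ y ∈ ball (p + s • (z - p)) (r / σ), ∃ w ∈ simplex T, y = p + s • (w - p) := by
      intro y hy
      refine ⟨p + s⁻¹ • (y - p), hb ?_, ?_⟩
      · have e : p + s⁻¹ • (y - p) - z = s⁻¹ • (y - (p + s • (z - p))) := by
          rw [smul_sub, smul_sub, smul_add, smul_smul, inv_mul_cancel₀ hs0.ne', one_smul]
          abel
        rw [mem_closedBall, dist_eq_norm, e, norm_smul, norm_inv, Real.norm_of_nonneg hs0.le,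
          inv_mul_le_iff₀ hs0]
        rw [mem_ball, dist_eq_norm] at hy
        refine hy.le.trans ?_
        rw [hs, div_mul_eq_mul_div, div_le_div_iff₀ hσ0 hh]
        nlinarith
      · simp [smul_smul, mul_inv_cancel₀ hs0.ne']
    refine ⟨p + s • (z - p), fun y hy => ?_, fun y hy => ?_⟩
    · obtain ⟨w, hw, rfl⟩ := hpt y hy
      exact (convex_simplex T).add_smul_sub_mem (subset_simplex T hpT) hw ⟨hs0.le, hs1⟩
    · obtain ⟨w, hw, rfl⟩ := hpt y hy
      have := dist_le_meshSize hw (subset_simplex T hpT)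
      rw [mem_closedBall, dist_eq_norm, add_sub_cancel_left, norm_smul,
        Real.norm_of_nonneg hs0.le, ← dist_eq_norm]
      calc s * dist w p ≤ s * meshSize T := mul_le_mul_of_nonneg_left this hs0.le
        _ = r := div_mul_cancel₀ _ hh.ne'
  choose! c hc1 hc2 using hball
  have hdisj : ((𝒯.star p : Finset _) : Set (Finset (Pt d))).PairwiseDisjoint
      fun T => ball (c T) (r / σ) := by
    intro T hT T' hT' hne
    exact (disjoint_interior (mem_star.1 hT).1 (mem_star.1 hT').1 hne).mono
      (interior_maximal (hc1 T hT) isOpen_ball) (interior_maximal (hc1 T' hT') isOpen_ball)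
  have hvol : ∑ T ∈ 𝒯.star p, volume (ball (c T) (r / σ)) ≤ volume (closedBall p r) := by
    rw [← measure_biUnion_finset hdisj fun _ _ => measurableSet_ball]
    exact measure_mono (Set.iUnion₂_subset fun T hT => hc2 T hT)
  have hω0 : volume (ball (0 : Pt d) 1) ≠ 0 := (measure_ball_pos volume _ one_pos).ne'
  have hωt : volume (ball (0 : Pt d) 1) ≠ ⊤ := measure_ball_lt_top.ne
  simp_rw [Measure.addHaar_ball_of_pos volume _ (div_pos hr0 hσ0)] at hvol
  rw [Measure.addHaar_closedBall volume _ hr0.le, finrank_euclideanSpace_fin, Finset.sum_const,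
    nsmul_eq_mul, ← mul_assoc, ENNReal.mul_le_mul_iff_left hω0 hωt] at hvol
  have h3 : ((𝒯.star p).card : ENNReal) = ENNReal.ofReal ((𝒯.star p).card : ℝ) := by simp
  rw [h3, ← ENNReal.ofReal_mul (by positivity), ENNReal.ofReal_le_ofReal_iff (by positivity),
    div_pow, mul_div_assoc', div_le_iff₀ (by positivity), mul_comm] at hvol
  exact le_of_mul_le_mul_left hvol (by positivity)

/-- The star of an interior vertex cannot split into two parts meeting only at `p`: a small sphere
around `p` is covered by the star and is connected. This is the step that needs `p ∈ Ω` and `d ≥ 2`.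
-/
theorem exists_common_vertices (hd : 2 ≤ d) {p : Pt d} (hp : p ∈ Ω) (hΩ : IsOpen Ω)
    {A : Finset (Finset (Pt d))} (hA : A ⊆ 𝒯.star p) (hne : A.Nonempty) (hneq : A ≠ 𝒯.star p) :
    ∃ T ∈ A, ∃ T' ∈ 𝒯.star p, T' ∉ A ∧ ∃ q ∈ T, q ∈ T' ∧ p ≠ q := by
  classical
  set B := 𝒯.star p \ A with hB
  have hBne : B.Nonempty := Finset.sdiff_nonempty.2 fun h => hneq (subset_antisymm hA h)
  have hBsub : B ⊆ 𝒯.star p := Finset.sdiff_subset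
  -- a small radius
  have h1 : ∀ᶠ r in nhdsWithin (0 : ℝ) (Set.Ioi 0), closedBall p r ⊆ Ω :=
    (eventually_closedBall_subset (hΩ.mem_nhds hp)).filter_mono nhdsWithin_le_nhds
  have h2 : ∀ᶠ r in nhdsWithin (0 : ℝ) (Set.Ioi 0), ∀ T ∈ 𝒯.elements, T ∉ 𝒯.star p →
      Disjoint (closedBall p r) (simplex T) := by
    rw [Filter.eventually_all_finset]
    intro T hT
    by_cases hTs : T ∈ 𝒯.star p
    · simp [hTs]
    · have hpT : p ∉ simplex T := by
        intro hpT
        obtain ⟨S, hS⟩ := hne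
        have hS' := mem_star.1 (hA hS)
        exact hTs (mem_star.2 ⟨hT, mem_of_mem_simplex hS'.1 hT hS'.2 hpT⟩)
      have := (eventually_closedBall_subset
        ((isCompact_simplex T).isClosed.isOpen_compl.mem_nhds hpT)).filter_mono
        (nhdsWithin_le_nhds (s := Set.Ioi 0))
      filter_upwards [this] with r hr _
      exact Set.disjoint_left.2 fun y hy => hr hy
  have h3 : ∀ᶠ r in nhdsWithin (0 : ℝ) (Set.Ioi 0), ∀ T ∈ 𝒯.star p,
      (sphere p r ∩ simplex T).Nonempty := by
    rw [Filter.eventually_all_finset]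
    intro T hT
    obtain ⟨hTe, hpT⟩ := mem_star.1 hT
    obtain ⟨q, hq, hqp⟩ := T.exists_mem_ne (by rw [(mem_elements.1 hTe).2]; omega) p
    have hpos : 0 < dist q p := dist_pos.2 hqp
    filter_upwards [Ioc_mem_nhdsGT hpos] with r hr
    refine ⟨p + (r / dist q p) • (q - p), ?_, ?_⟩
    · rw [mem_sphere, dist_eq_norm, add_sub_cancel_left, norm_smul, ← dist_eq_norm,
        Real.norm_of_nonneg (div_nonneg hr.1.le hpos.le), div_mul_cancel₀ _ hpos.ne']
    · exact (convex_simplex T).add_smul_sub_mem (subset_simplex T hpT) (subset_simplex T hq)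
        ⟨div_nonneg hr.1.le hpos.le, (div_le_one hpos).2 hr.2⟩
  obtain ⟨r, h1, h2, h3, hr⟩ := (h1.and (h2.and (h3.and self_mem_nhdsWithin))).exists
  have hrank : 1 < Module.rank ℝ (Pt d) := by
    rw [← Module.finrank_eq_rank, finrank_euclideanSpace_fin]
    exact_mod_cast hd
  -- Both closed families meet the sphere and together cover it, so they have a common point `y` on
  -- it.
  have hconn := isPreconnected_closed_iff.1 (isPreconnected_sphere hrank p r)
    (⋃ T ∈ A, simplex T) (⋃ T ∈ B, simplex T)
    (A.finite_toSet.isClosed_biUnion fun T _ => (isCompact_simplex T).isClosed)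
    (B.finite_toSet.isClosed_biUnion fun T _ => (isCompact_simplex T).isClosed)
    (fun y hy => by
      obtain ⟨T, hT, hyT⟩ := exists_mem_simplex (𝒯 := 𝒯)
        (subset_closure (h1 (sphere_subset_closedBall hy)))
      have hTs : T ∈ 𝒯.star p := by
        by_contra hTs
        exact Set.disjoint_left.1 (h2 T hT hTs) (sphere_subset_closedBall hy) hyT
      by_cases hTA : T ∈ A
      · exact Or.inl (Set.mem_biUnion hTA hyT)
      · exact Or.inr (Set.mem_biUnion (Finset.mem_sdiff.2 ⟨hTs, hTA⟩ : T ∈ B) hyT))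
    (by
      obtain ⟨T, hT⟩ := hne
      obtain ⟨y, hy, hyT⟩ := h3 T (hA hT)
      exact ⟨y, hy, Set.mem_biUnion hT hyT⟩)
    (by
      obtain ⟨T, hT⟩ := hBne
      obtain ⟨y, hy, hyT⟩ := h3 T (hBsub hT)
      exact ⟨y, hy, Set.mem_biUnion hT hyT⟩)
  obtain ⟨y, hy, hyA, hyB⟩ := hconn
  simp only [Set.mem_iUnion, exists_prop] at hyA hyB
  obtain ⟨T, hT, hyT⟩ := hyA
  obtain ⟨T', hT', hyT'⟩ := hyB
  refine ⟨T, hT, T', hBsub hT', (Finset.mem_sdiff.1 hT').2, ?_⟩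
  -- The intersection of the two simplices is the hull of their common vertices. If `p` were the
  -- only one, `y` would equal `p`, which is not on the sphere.
  by_contra! hcon
  have hmem : y ∈ simplex T ∩ simplex T' := ⟨hyT, hyT'⟩
  rw [simplex_inter_simplex (mem_star.1 (hA hT)).1 (mem_star.1 (hBsub hT')).1] at hmem
  have hsub : ((T : Set (Pt d)) ∩ T') ⊆ {p} := fun q hq => (hcon q hq.1 hq.2).symm
  have := convexHull_min hsub (convex_singleton p) hmem
  rw [Set.mem_singleton_iff.1 this, mem_sphere, dist_self] at hy
  exact (Set.mem_Ioi.1 hr).ne hy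

/-- A bound for the ratio of the sizes of elements with a common point in the domain. -/
noncomputable def ratioBound (d : ℕ) (σ : ℝ) : ℝ := σ ^ (starBound d σ + 1)

/-- Either the elements share an edge, which costs one factor `σ`, or they share only a vertex. In
the latter case that vertex is `y ∈ Ω`, and a chain of common edges through its star connects them.
-/
theorem meshSize_le_of_common_point (hd : 2 ≤ d) (hσ : 𝒯.IsShapeRegular σ) (hσ1 : 1 ≤ σ)
    (hΩ : IsOpen Ω) {T T' : Finset (Pt d)} (hT : T ∈ 𝒯.elements) (hT' : T' ∈ 𝒯.elements)
    {y : Pt d} (hy : y ∈ Ω) (hyT : y ∈ simplex T) (hyT' : y ∈ simplex T') :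
    meshSize T' ≤ ratioBound d σ * meshSize T := by
  classical
  have hd0 : 0 < d := by omega
  have hσ0 : 0 ≤ σ := by linarith
  have hmem : y ∈ simplex T ∩ simplex T' := ⟨hyT, hyT'⟩
  rw [simplex_inter_simplex hT hT'] at hmem
  have hne : ((T : Set (Pt d)) ∩ T').Nonempty := convexHull_nonempty_iff.1 ⟨y, hmem⟩
  obtain ⟨p, hpT, hpT'⟩ := hne
  have hmul : ∀ n ≤ starBound d σ + 1, σ ^ n * meshSize T ≤ ratioBound d σ * meshSize T :=
    fun n hn => mul_le_mul_of_nonneg_right (pow_le_pow_right₀ hσ1 hn)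
      (meshSize_pos hd0 hσ hT).le
  by_cases hex : ∃ q ∈ T, q ∈ T' ∧ p ≠ q
  · obtain ⟨q, hq, hq', hpq⟩ := hex
    refine (meshSize_le_of_common_edge hd0 hσ hσ0 hT' hpT' hq' hpT hq hpq).trans ?_
    simpa using hmul 1 (by omega)
  · push Not at hex
    have hsub : ((T : Set (Pt d)) ∩ T') ⊆ {p} := fun q hq => (hex q hq.1 hq.2).symm
    have hyp : y = p := convexHull_min hsub (convex_singleton p) hmem
    rw [hyp] at hy
    refine (le_pow_card_mul_of_forall_subset (F := 𝒯.star p) (a := T) (h := meshSize) hσ1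
      (fun _ => diam_nonneg) (mem_star.2 ⟨hT, hpT⟩) (fun A hA hTA hne => ?_) T'
      (mem_star.2 ⟨hT', hpT'⟩)).trans
      (hmul _ ((card_star_le hd0 hσ hσ1 p).trans (Nat.le_succ _)))
    obtain ⟨S, hS, S', hS', hSA, q, hq, hq', hpq⟩ :=
      exists_common_vertices hd hy hΩ hA ⟨T, hTA⟩ hne
    exact ⟨S, hS, S', hS', hSA, meshSize_le_of_common_edge hd0 hσ hσ0 (mem_star.1 hS').1
      (mem_star.1 hS').2 hq' (mem_star.1 (hA hS)).2 hq hpq⟩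

/-! ### Patches: elements touching `T` that are reachable inside the domain. -/

open scoped Classical in
/-- The elements having a vertex in common with `T`. -/
noncomputable def touching (𝒯 : Triangulation Ω) (T : Finset (Pt d)) : Finset (Finset (Pt d)) :=
  𝒯.elements.filter fun T' => ∃ p ∈ T, p ∈ T'

theorem mem_touching {T T' : Finset (Pt d)} :
    T' ∈ 𝒯.touching T ↔ T' ∈ 𝒯.elements ∧ ∃ p ∈ T, p ∈ T' := by
  simp [touching]

/-- A bound for the number of elements touching a given element. -/
noncomputable def touchingBound (d : ℕ) (σ : ℝ) : ℕ := (d + 1) * starBound d σ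

theorem card_touching_le (hd : 0 < d) (hσ : 𝒯.IsShapeRegular σ) (hσ1 : 1 ≤ σ)
    {T : Finset (Pt d)} (hT : T ∈ 𝒯.elements) : (𝒯.touching T).card ≤ touchingBound d σ := by
  classical
  have hsub : 𝒯.touching T ⊆ T.biUnion fun p => 𝒯.star p := fun T' hT' => by
    obtain ⟨h1, p, hp, hp'⟩ := mem_touching.1 hT'
    exact Finset.mem_biUnion.2 ⟨p, hp, mem_star.2 ⟨h1, hp'⟩⟩
  refine (Finset.card_le_card hsub).trans ?_
  rw [touchingBound, ← (mem_elements.1 hT).2]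
  exact Finset.card_biUnion_le_card_mul _ _ _ fun p _ => card_star_le hd hσ hσ1 p

/-- Two elements are adjacent relative to `T` if they have a common point in the domain and the
second one touches `T`. -/
def AdjRel (𝒯 : Triangulation Ω) (T T₁ T₂ : Finset (Pt d)) : Prop :=
  T₂ ∈ 𝒯.touching T ∧ ∃ y ∈ Ω, y ∈ simplex T₁ ∧ y ∈ simplex T₂

open scoped Classical in
/-- The elements that can be reached from `T` inside the domain through elements touching `T`. -/
noncomputable def patch (𝒯 : Triangulation Ω) (T : Finset (Pt d)) : Finset (Finset (Pt d)) :=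
  (𝒯.touching T).filter fun T' => Relation.ReflTransGen (𝒯.AdjRel T) T T'

theorem mem_patch {T T' : Finset (Pt d)} :
    T' ∈ 𝒯.patch T ↔ T' ∈ 𝒯.touching T ∧ Relation.ReflTransGen (𝒯.AdjRel T) T T' := by
  simp [patch]

theorem patch_subset_touching (T : Finset (Pt d)) : 𝒯.patch T ⊆ 𝒯.touching T :=
  fun _ h => (mem_patch.1 h).1

theorem mem_elements_of_mem_patch {T T' : Finset (Pt d)} (h : T' ∈ 𝒯.patch T) :
    T' ∈ 𝒯.elements := (mem_touching.1 (mem_patch.1 h).1).1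

theorem self_mem_patch {T : Finset (Pt d)} (hT : T ∈ 𝒯.elements) : T ∈ 𝒯.patch T := by
  obtain ⟨p, hp⟩ : T.Nonempty := Finset.card_pos.1 (by rw [(mem_elements.1 hT).2]; omega)
  exact mem_patch.2 ⟨mem_touching.2 ⟨hT, p, hp, hp⟩, Relation.ReflTransGen.refl⟩

theorem mem_patch_of_common_point {T T₁ T₂ : Finset (Pt d)} (h₁ : T₁ ∈ 𝒯.patch T)
    (h₂ : T₂ ∈ 𝒯.touching T) {y : Pt d} (hy : y ∈ Ω) (hy₁ : y ∈ simplex T₁)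
    (hy₂ : y ∈ simplex T₂) : T₂ ∈ 𝒯.patch T :=
  mem_patch.2 ⟨h₂, (mem_patch.1 h₁).2.tail ⟨h₂, y, hy, hy₁, hy₂⟩⟩

/-- Connectedness of the patch, in the form required by `le_pow_card_mul_of_forall_subset`. -/
theorem exists_adjacent_of_ne_patch {T : Finset (Pt d)} {A : Finset (Finset (Pt d))}
    (hA : A ⊆ 𝒯.patch T) (hTA : T ∈ A) (hne : A ≠ 𝒯.patch T) :
    ∃ S ∈ A, ∃ S' ∈ 𝒯.patch T, S' ∉ A ∧ ∃ y ∈ Ω, y ∈ simplex S ∧ y ∈ simplex S' := by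
  by_contra! hcon
  refine hne (subset_antisymm hA fun S hS => ?_)
  have hreach := (mem_patch.1 hS).2
  clear hS
  induction hreach with
  | refl => exact hTA
  | @tail B C _ hBC ih =>
    by_contra hC
    obtain ⟨hCt, y, hy, hyB, hyC⟩ := hBC
    exact hcon B ih C (mem_patch_of_common_point (hA ih) hCt hy hyB hyC) hC y hy hyB hyC

/-- A bound for the ratio of the sizes of elements in a patch. -/
noncomputable def patchRatio (d : ℕ) (σ : ℝ) : ℝ := ratioBound d σ ^ touchingBound d σ

theorem one_le_ratioBound (hσ1 : 1 ≤ σ) : 1 ≤ ratioBound d σ := one_le_pow₀ hσ1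

theorem one_le_patchRatio (hσ1 : 1 ≤ σ) : 1 ≤ patchRatio d σ :=
  one_le_pow₀ (one_le_ratioBound hσ1)

theorem meshSize_patch (hd : 2 ≤ d) (hσ : 𝒯.IsShapeRegular σ) (hσ1 : 1 ≤ σ)
    (hΩ : IsOpen Ω) {T T' : Finset (Pt d)} (hT : T ∈ 𝒯.elements) (hT' : T' ∈ 𝒯.patch T) :
    meshSize T' ≤ patchRatio d σ * meshSize T ∧ meshSize T ≤ patchRatio d σ * meshSize T' := by
  have hd0 : 0 < d := by omega
  have h1 := one_le_ratioBound (d := d) hσ1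
  have hpow : ratioBound d σ ^ (𝒯.patch T).card ≤ patchRatio d σ :=
    pow_le_pow_right₀ h1 ((Finset.card_le_card (patch_subset_touching T)).trans
      (card_touching_le hd0 hσ hσ1 hT))
  have hTpos := meshSize_pos hd0 hσ hT
  have hT'pos := meshSize_pos hd0 hσ (mem_elements_of_mem_patch hT')
  have hstep : ∀ S ∈ 𝒯.patch T, ∀ S' ∈ 𝒯.patch T, ∀ y ∈ Ω, y ∈ simplex S → y ∈ simplex S' →
      meshSize S' ≤ ratioBound d σ * meshSize S := fun S hS S' hS' y hy hyS hyS' =>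
    meshSize_le_of_common_point hd hσ hσ1 hΩ (mem_elements_of_mem_patch hS)
      (mem_elements_of_mem_patch hS') hy hyS hyS'
  constructor
  · refine (le_pow_card_mul_of_forall_subset (F := 𝒯.patch T) (a := T) (h := meshSize) h1
      (fun _ => diam_nonneg) (self_mem_patch hT) (fun A hA hTA hne => ?_) T' hT').trans
      (mul_le_mul_of_nonneg_right hpow hTpos.le)
    obtain ⟨S, hS, S', hS', hSA, y, hy, hyS, hyS'⟩ := exists_adjacent_of_ne_patch hA hTA hne
    exact ⟨S, hS, S', hS', hSA, hstep S (hA hS) S' hS' y hy hyS hyS'⟩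
  -- The reverse comparison is the same chain argument applied to the inverse sizes.
  · have h2 := (le_pow_card_mul_of_forall_subset (F := 𝒯.patch T) (a := T)
      (h := fun S => (meshSize S)⁻¹) h1
      (fun _ => inv_nonneg.2 diam_nonneg) (self_mem_patch hT) (fun A hA hTA hne => ?_) T' hT').trans
      (mul_le_mul_of_nonneg_right hpow (inv_nonneg.2 hTpos.le))
    · rw [← div_eq_mul_inv, inv_eq_one_div, div_le_div_iff₀ hT'pos hTpos] at h2
      linarith
    · obtain ⟨S, hS, S', hS', hSA, y, hy, hyS, hyS'⟩ := exists_adjacent_of_ne_patch hA hTA hne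
      have h3 := hstep S' hS' S (hA hS) y hy hyS' hyS
      have hSpos := meshSize_pos hd0 hσ (mem_elements_of_mem_patch (hA hS))
      have hS'pos := meshSize_pos hd0 hσ (mem_elements_of_mem_patch hS')
      refine ⟨S, hS, S', hS', hSA, ?_⟩
      rw [← div_eq_mul_inv, inv_eq_one_div, div_le_div_iff₀ hS'pos hSpos]
      linarith

end Triangulation

/-! ### Piecewise Lipschitz functions along paths. -/

/-- A function on an interval that is Lipschitz on each set of a finite closed cover is Lipschitz. -/
theorem abs_sub_le_of_finite_closed_cover {ι : Type*} {g : ℝ → ℝ} {L b : ℝ} {A : ι → Set ℝ}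
    (F : Finset ι) {a : ℝ} (hab : a ≤ b) (hA : ∀ i ∈ F, IsClosed (A i))
    (hcov : Set.Icc a b ⊆ ⋃ i ∈ F, A i)
    (hg : ∀ i ∈ F, ∀ s ∈ A i ∩ Set.Icc a b, ∀ t ∈ A i ∩ Set.Icc a b, |g s - g t| ≤ L * |s - t|) :
    |g b - g a| ≤ L * (b - a) := by
  classical
  induction F using Finset.strongInduction generalizing a with
  | H F ih =>
    obtain ⟨i, hi, hai⟩ : ∃ i ∈ F, a ∈ A i := by simpa using hcov (Set.left_mem_Icc.2 hab)
    have hK : IsCompact (A i ∩ Set.Icc a b) := isCompact_Icc.inter_left (hA i hi)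
    -- Go directly from `a` to the last time `s` at which `A i` is visited. The set `A i` is not
    -- needed after `s`, so the induction continues with one set fewer, however often the path
    -- returns to `A i` before `s`.
    have hs := hK.sSup_mem ⟨a, hai, Set.left_mem_Icc.2 hab⟩
    have hub : ∀ t ∈ A i ∩ Set.Icc a b, t ≤ sSup (A i ∩ Set.Icc a b) :=
      fun t ht => le_csSup hK.bddAbove ht
    set s := sSup (A i ∩ Set.Icc a b) with hsdef
    have h1 : |g s - g a| ≤ L * (s - a) := by
      have := hg i hi s hs a ⟨hai, Set.left_mem_Icc.2 hab⟩
      rwa [abs_of_nonneg (sub_nonneg.2 hs.2.1)] at this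
    rcases hs.2.2.eq_or_lt with hsb | hsb
    · rwa [hsb] at h1
    have hcl : IsClosed (⋃ j ∈ F.erase i, A j) :=
      (F.erase i).finite_toSet.isClosed_biUnion fun j hj => hA j (Finset.mem_of_mem_erase hj)
    have hIoc : Set.Ioc s b ⊆ ⋃ j ∈ F.erase i, A j := by
      intro t ht
      have htab : t ∈ Set.Icc a b := ⟨hs.2.1.trans ht.1.le, ht.2⟩
      obtain ⟨j, hj, htj⟩ : ∃ j ∈ F, t ∈ A j := by simpa using hcov htab
      refine Set.mem_biUnion (Finset.mem_coe.2 (Finset.mem_erase.2 ⟨?_, hj⟩)) htj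
      rintro rfl
      exact absurd (hub t ⟨htj, htab⟩) (not_le.2 ht.1)
    have hIcc : Set.Icc s b ⊆ ⋃ j ∈ F.erase i, A j := by
      rw [← closure_Ioc hsb.ne]
      exact hcl.closure_subset_iff.2 hIoc
    have hsub : Set.Icc s b ⊆ Set.Icc a b := Set.Icc_subset_Icc_left hs.2.1
    have h2 := ih (F.erase i) (Finset.erase_ssubset hi) hsb.le
      (fun j hj => hA j (Finset.mem_of_mem_erase hj)) hIcc
      (fun j hj u hu t ht => hg j (Finset.mem_of_mem_erase hj) u ⟨hu.1, hsub hu.2⟩ t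
        ⟨ht.1, hsub ht.2⟩)
    calc |g b - g a| ≤ |g b - g s| + |g s - g a| := abs_sub_le _ _ _
      _ ≤ L * (b - a) := by linarith

/-- A function that is Lipschitz on each set of a finite closed cover of a Lipschitz path is
Lipschitz along the path. -/
theorem abs_sub_le_of_path {E ι : Type*} [PseudoMetricSpace E] {f : E → ℝ} {γ : ℝ → E}
    {L ℓ a b : ℝ} {S : ι → Set E} (hL : 0 ≤ L) (hℓ : 0 ≤ ℓ) (F : Finset ι) (hab : a ≤ b)
    (hS : ∀ i ∈ F, IsClosed (S i))
    (hγ : ∀ s ∈ Set.Icc a b, ∀ t ∈ Set.Icc a b, dist (γ s) (γ t) ≤ ℓ * |s - t|)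
    (hcov : ∀ t ∈ Set.Icc a b, ∃ i ∈ F, γ t ∈ S i)
    (hf : ∀ i ∈ F, ∀ x ∈ S i, ∀ y ∈ S i, |f x - f y| ≤ L * dist x y) :
    |f (γ b) - f (γ a)| ≤ L * ℓ * (b - a) := by
  have hcont : ContinuousOn γ (Set.Icc a b) := by
    refine (LipschitzOnWith.of_dist_le_mul (K := ⟨ℓ, hℓ⟩) fun s hs t ht => ?_).continuousOn
    rw [Real.dist_eq]
    exact hγ s hs t ht
  refine abs_sub_le_of_finite_closed_cover (g := fun t => f (γ t))
    (A := fun i => Set.Icc a b ∩ γ ⁻¹' S i) F hab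
    (fun i hi => hcont.preimage_isClosed_of_isClosed isClosed_Icc (hS i hi))
    (fun t ht => ?_) (fun i hi s hs t ht => ?_)
  · obtain ⟨i, hi, h⟩ := hcov t ht
    exact Set.mem_biUnion hi ⟨ht, h⟩
  · refine (hf i hi _ hs.1.2 _ ht.1.2).trans ?_
    rw [mul_assoc]
    exact mul_le_mul_of_nonneg_left (hγ s hs.2 t ht.2) hL

/-! ### Short paths in the domain stay in the patch. -/

namespace Triangulation

variable {d k : ℕ} {Ω : Set (Pt d)} {𝒯 : Triangulation Ω} {σ : ℝ}

/-- The sum of the nodal basis functions of the vertices of an element. -/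
theorem exists_hat (hd : 0 < d) (hσ : 𝒯.IsShapeRegular σ) (T : Finset (Pt d)) :
    ∃ φ : Pt d → ℝ, (∀ y ∈ simplex T, T ∈ 𝒯.elements → φ y = 1) ∧
      (∀ S ∈ 𝒯.elements, S ∉ 𝒯.touching T → ∀ y ∈ simplex S, φ y = 0) ∧
      ∀ S ∈ 𝒯.elements, ∀ x ∈ simplex S, ∀ y ∈ simplex S,
        |φ x - φ y| ≤ σ / meshSize S * dist x y := by
  classical
  have hex : ∀ S ∈ 𝒯.elements, ∃ A : Pt d →ᵃ[ℝ] ℝ, (∀ p ∈ S, A p = if p ∈ T then 1 else 0) ∧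
      ∀ x y, |A x - A y| ≤ σ / meshSize S * dist x y := fun S hS =>
    exists_interpolant hd hσ hS (f := fun p => if p ∈ T then 1 else 0)
      (fun p _ => by split_ifs <;> simp)
  choose! A hA hL using hex
  -- The choice of an element containing `y` is immaterial: two interpolants agree at the common
  -- vertices, hence on the common face.
  let φ : Pt d → ℝ := fun y =>
    if h : ∃ S ∈ 𝒯.elements, y ∈ simplex S then A h.choose y else 0
  have hφ : ∀ S ∈ 𝒯.elements, ∀ y ∈ simplex S, φ y = A S y := by
    intro S hS y hy
    have h : ∃ S ∈ 𝒯.elements, y ∈ simplex S := ⟨S, hS, hy⟩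
    have h1 : φ y = A h.choose y := dif_pos h
    have hmem : y ∈ simplex h.choose ∩ simplex S := ⟨h.choose_spec.2, hy⟩
    rw [simplex_inter_simplex h.choose_spec.1 hS] at hmem
    rw [h1]
    exact affineMap_eq_on_convexHull
      (fun p hp => by rw [hA _ h.choose_spec.1 p hp.1, hA S hS p hp.2]) y hmem
  have hconst : ∀ (S : Finset (Pt d)) (c : ℝ), (∀ p ∈ S, A S p = c) → ∀ y ∈ simplex S,
      A S y = c := fun S c h =>
    affineMap_eq_on_convexHull (B := AffineMap.const ℝ (Pt d) c) h
  refine ⟨φ, fun y hy hT => ?_, fun S hS hST y hy => ?_, fun S hS x hx y hy => ?_⟩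
  · rw [hφ T hT y hy]
    exact hconst T 1 (fun p hp => by rw [hA T hT p hp, if_pos hp]) y hy
  · rw [hφ S hS y hy]
    refine hconst S 0 (fun p hp => ?_) y hy
    rw [hA S hS p hp, if_neg]
    exact fun hpT => hST (mem_touching.2 ⟨hS, p, hpT, hp⟩)
  · rw [hφ S hS x hx, hφ S hS y hy]
    exact hL S hS x y

/-- A path in the domain that starts in `T` and is short compared with the size of `T` stays in the
patch of `T`. -/
theorem exists_mem_patch_of_path (hd : 2 ≤ d) (hσ : 𝒯.IsShapeRegular σ) (hσ1 : 1 ≤ σ)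
    (hΩ : IsOpen Ω) {T : Finset (Pt d)} (hT : T ∈ 𝒯.elements) {γ : ℝ → Pt d} {ℓ b : ℝ}
    (hℓ : 0 ≤ ℓ) (hγ : ∀ s ∈ Set.Icc 0 b, ∀ t ∈ Set.Icc 0 b, dist (γ s) (γ t) ≤ ℓ * |s - t|)
    (hγΩ : ∀ t ∈ Set.Icc 0 b, γ t ∈ Ω) (hγ0 : γ 0 ∈ simplex T)
    (hlen : σ * patchRatio d σ * (ℓ * b) < meshSize T) :
    ∀ t ∈ Set.Icc 0 b, ∃ T' ∈ 𝒯.patch T, γ t ∈ simplex T' := by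
  classical
  have hd0 : 0 < d := by omega
  have hσ0 : 0 < σ := by linarith
  have hT0 := meshSize_pos hd0 hσ hT
  have hK1 : 1 ≤ patchRatio d σ := one_le_patchRatio hσ1
  by_contra! hcon
  obtain ⟨t₁, ht₁, hbad₁⟩ := hcon
  have hb : 0 ≤ b := ht₁.1.trans ht₁.2
  have hcont : ContinuousOn γ (Set.Icc 0 b) := by
    refine (LipschitzOnWith.of_dist_le_mul (K := ⟨ℓ, hℓ⟩) fun s hs t ht => ?_).continuousOn
    rw [Real.dist_eq]
    exact hγ s hs t ht
  set P : Set (Pt d) := ⋃ S ∈ 𝒯.patch T, simplex S with hP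
  have hPcl : IsClosed P := (𝒯.patch T).finite_toSet.isClosed_biUnion fun S _ =>
    (isCompact_simplex S).isClosed
  have hmemP : ∀ y, y ∈ P ↔ ∃ S ∈ 𝒯.patch T, y ∈ simplex S := fun y => by simp [hP]
  set bad : Set ℝ := {t | t ∈ Set.Icc 0 b ∧ γ t ∉ P} with hbad
  have hne : bad.Nonempty := ⟨t₁, ht₁, fun h => by
    obtain ⟨S, hS, h⟩ := (hmemP _).1 h
    exact hbad₁ S hS h⟩
  have hbdd : BddBelow bad := ⟨0, fun t ht => ht.1.1⟩
  -- The time at which the path leaves the patch. Since the patch is closed, the path still belongs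
  -- to it at `τ`.
  set τ := sInf bad with hτ
  have hτ0 : 0 ≤ τ := le_csInf hne fun t ht => ht.1.1
  have hτb : τ ≤ b := by
    obtain ⟨t, ht⟩ := hne
    exact (csInf_le hbdd ht).trans ht.1.2
  have hτI : τ ∈ Set.Icc 0 b := ⟨hτ0, hτb⟩
  have hQcl : IsClosed (Set.Icc 0 b ∩ γ ⁻¹' P) :=
    hcont.preimage_isClosed_of_isClosed isClosed_Icc hPcl
  have hIcc : ∀ t ∈ Set.Icc 0 τ, γ t ∈ P := by
    have hIco : Set.Ico 0 τ ⊆ Set.Icc 0 b ∩ γ ⁻¹' P := fun t ht => by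
      have htI : t ∈ Set.Icc 0 b := ⟨ht.1, ht.2.le.trans hτb⟩
      refine ⟨htI, ?_⟩
      by_contra h
      exact absurd (csInf_le hbdd (show t ∈ bad from ⟨htI, h⟩)) (not_le.2 ht.2)
    rcases hτ0.eq_or_lt with h0 | h0
    · intro t ht
      have : t = 0 := le_antisymm (ht.2.trans h0.ge) ht.1
      rw [this]
      exact (hmemP _).2 ⟨T, self_mem_patch hT, hγ0⟩
    · intro t ht
      rw [← closure_Ico h0.ne] at ht
      exact (hQcl.closure_subset_iff.2 hIco ht).2
  obtain ⟨S₀, hS₀, hτS₀⟩ := (hmemP _).1 (hIcc τ ⟨hτ0, le_rfl⟩)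
  obtain ⟨φ, hφ1, hφ0, hφL⟩ := exists_hat (𝒯 := 𝒯) hd0 hσ T
  have hall : ∀ S ∈ 𝒯.elements, γ τ ∈ simplex S → S ∈ 𝒯.patch T := by
    intro S hS hτS
    by_contra hSp
    -- An element at `γ τ` outside the patch cannot touch `T`, so the hat function has dropped from
    -- `1` to `0`. Its slope on the patch is at most `σ K / h_T`, with `K` the patch ratio, and the
    -- path is too short for this drop.
    have hSt : S ∉ 𝒯.touching T := fun h =>
      hSp (mem_patch_of_common_point hS₀ h (hγΩ τ hτI) hτS₀ hτS)
    have h0 := hφ0 S hS hSt _ hτS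
    have h1 := hφ1 _ hγ0 hT
    have hsub : Set.Icc 0 τ ⊆ Set.Icc 0 b := Set.Icc_subset_Icc_right hτb
    have h2 := abs_sub_le_of_path (f := φ) (γ := γ) (S := simplex)
      (L := σ * patchRatio d σ / meshSize T) (by positivity) hℓ (𝒯.patch T)
      hτ0 (fun S _ => (isCompact_simplex S).isClosed)
      (fun s hs t ht => hγ s (hsub hs) t (hsub ht)) (fun t ht => (hmemP _).1 (hIcc t ht))
      (fun S hS x hx y hy => (hφL S (mem_elements_of_mem_patch hS) x hx y hy).trans
        (mul_le_mul_of_nonneg_right (by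
          have h3 := (meshSize_patch hd hσ hσ1 hΩ hT hS).2
          rw [div_le_div_iff₀ (meshSize_pos hd0 hσ (mem_elements_of_mem_patch hS)) hT0, mul_assoc]
          exact mul_le_mul_of_nonneg_left h3 hσ0.le) dist_nonneg))
    rw [h0, h1, zero_sub, abs_neg, abs_one, sub_zero, mul_assoc, div_mul_eq_mul_div,
      le_div_iff₀ hT0, one_mul] at h2
    have h4 : σ * patchRatio d σ * (ℓ * τ) ≤ σ * patchRatio d σ * (ℓ * b) := by gcongr
    linarith
  -- near `τ` the path only meets elements containing `γ τ`
  set N : Set (Pt d) := ⋃ S ∈ 𝒯.elements.filter fun S => γ τ ∉ simplex S, simplex S with hN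
  have hNcl : IsClosed N := (Finset.finite_toSet _).isClosed_biUnion fun S _ =>
    (isCompact_simplex S).isClosed
  have hτN : γ τ ∈ Nᶜ := by
    simp only [hN, Set.mem_compl_iff, Set.mem_iUnion, Finset.mem_filter, not_exists]
    exact fun S hS h => hS.2 h
  have hev : ∀ᶠ t in nhdsWithin τ (Set.Icc 0 b), γ t ∈ Nᶜ :=
    (hcont τ hτI).eventually (hNcl.isOpen_compl.mem_nhds hτN)
  obtain ⟨ε, hε, hεN⟩ := Metric.eventually_nhds_iff.1 (eventually_nhdsWithin_iff.1 hev)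
  obtain ⟨t, ht, htε⟩ := exists_lt_of_csInf_lt hne (show sInf bad < τ + ε by linarith)
  have hτt : τ ≤ t := csInf_le hbdd ht
  have htN := hεN (by rw [Real.dist_eq, abs_of_nonneg (by linarith)]; linarith) ht.1
  obtain ⟨S, hS, htS⟩ := exists_mem_simplex (𝒯 := 𝒯) (subset_closure (hγΩ t ht.1))
  refine ht.2 ((hmemP _).2 ⟨S, hall S hS ?_, htS⟩)
  by_contra h
  exact htN (Set.mem_biUnion (Finset.mem_coe.2 (Finset.mem_filter.2 ⟨hS, h⟩)) htS)

end Triangulation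

/-! ### Uniform bilipschitz charts and area bounds for compact hypersurfaces. -/

section Hypersurfaces

variable {d : ℕ}

/-- `S` has at each of its points in `A` a bilipschitz chart of radius `r` that covers all
points of `S` nearby. -/
def HasChartsOn (A S : Set (Pt d)) (r : ℝ) : Prop :=
  ∀ x ∈ S, x ∈ A → ∃ Φ : Pt (d - 1) → Pt d, Φ 0 = x ∧ (∀ a ∈ closedBall 0 r, Φ a ∈ S) ∧
    (∀ a ∈ closedBall 0 r, ∀ b ∈ closedBall 0 r,
      dist (Φ a) (Φ b) ≤ 2 * dist a b ∧ dist a b ≤ 2 * dist (Φ a) (Φ b)) ∧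
    ∀ y ∈ S, dist y x ≤ r / 2 → ∃ a ∈ closedBall 0 (2 * dist y x), Φ a = y

theorem HasChartsOn.mono {A B S : Set (Pt d)} {r s : ℝ} (h : HasChartsOn A S r) (hBA : B ⊆ A)
    (hsr : s ≤ r) : HasChartsOn B S s := by
  intro x hxS hxB
  obtain ⟨Φ, h0, h1, h2, h3⟩ := h x hxS (hBA hxB)
  have hsub : closedBall (0 : Pt (d - 1)) s ⊆ closedBall 0 r := closedBall_subset_closedBall hsr
  exact ⟨Φ, h0, fun a ha => h1 a (hsub ha), fun a ha b hb => h2 a (hsub ha) b (hsub hb),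
    fun y hy hyx => h3 y hy (hyx.trans (by linarith))⟩

theorem HasChartsOn.image {S : Set (Pt d)} {r : ℝ} (h : HasChartsOn Set.univ S r)
    (g : Pt d ≃ᵃⁱ[ℝ] Pt d) : HasChartsOn Set.univ (g '' S) r := by
  rintro _ ⟨x, hx, rfl⟩ -
  obtain ⟨Φ, h0, h1, h2, h3⟩ := h x hx trivial
  refine ⟨fun a => g (Φ a), by simp [h0], fun a ha => ⟨_, h1 a ha, rfl⟩, fun a ha b hb => ?_, ?_⟩
  · simpa only [g.dist_map] using h2 a ha b hb
  · rintro _ ⟨y, hy, rfl⟩ hyx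
    simp only [g.dist_map] at hyx ⊢
    obtain ⟨a, ha, rfl⟩ := h3 y hy hyx
    exact ⟨a, ha, rfl⟩

/-- The implicit function theorem parametrizes `M` near `x₀` by the kernel of the derivative,
identified isometrically with `ℝ^(d-1)`. Translating the parameter turns this one map into charts
centred at all nearby points, with a common radius. -/
theorem exists_chartsOn_nhds {M : Set (Pt d)} (hM : IsCompactC1Hypersurface M) {x₀ : Pt d}
    (hx₀ : x₀ ∈ M) : ∃ V ∈ nhds x₀, ∃ r > 0, HasChartsOn V M r := by
  obtain ⟨U, φ, hU, hxU, hφ, hφ', hMU⟩ := hM.isLevelSet x₀ hx₀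
  have hstrict : HasStrictFDerivAt φ (fderiv ℝ φ x₀) x₀ :=
    (hφ.contDiffAt (hU.mem_nhds hxU)).hasStrictFDerivAt one_ne_zero
  set f' := fderiv ℝ φ x₀ with hf'
  have hrange : f'.range = ⊤ := by
    refine LinearMap.range_eq_top.2 (LinearMap.surjective (f := f'.toLinearMap) ?_)
    exact fun h => hφ' (ContinuousLinearMap.coe_injective h)
  have hzero : φ x₀ = 0 := by
    have : x₀ ∈ M ∩ U := ⟨hx₀, hxU⟩
    rw [hMU] at this
    exact this.2
  have hmemM : ∀ y ∈ U, (y ∈ M ↔ φ y = 0) := fun y hy => by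
    have : y ∈ M ∩ U ↔ y ∈ {y ∈ U | φ y = 0} := by rw [hMU]
    simpa [hy] using this
  have hker : Module.finrank ℝ f'.ker = d - 1 := by
    have h1 := LinearMap.finrank_range_add_finrank_ker f'.toLinearMap
    have h2 : Module.finrank ℝ f'.range = 1 := by rw [hrange]; simp
    rw [finrank_euclideanSpace_fin] at h1
    omega
  let ι : Pt (d - 1) ≃ₗᵢ[ℝ] f'.ker :=
    ((stdOrthonormalBasis ℝ f'.ker).reindex (finCongr hker)).repr.symm
  set Ψ := hstrict.implicitFunction φ f' hrange (φ x₀) with hΨ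
  set H := hstrict.implicitToOpenPartialHomeomorph φ f' hrange with hH
  -- The derivative at `0` is the inclusion of the kernel, an isometry. Approximation within `1 / 2`
  -- makes distances change by factors between `1 / 2` and `3 / 2`.
  obtain ⟨s, hs, happ⟩ := (hstrict.to_implicitFunction hrange).approximates_deriv_on_nhds
    (c := 1 / 2) (Or.inr (by norm_num))
  have hΨ0 : Ψ 0 = x₀ := hstrict.implicitFunction_apply_image hrange
  have hΨc : Filter.Tendsto Ψ (nhds 0) (nhds x₀) := by
    have := (hstrict.to_implicitFunction hrange).continuousAt.tendsto
    rwa [← hΨ, hΨ0] at this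
  have hlevel : ∀ᶠ a in nhds (0 : f'.ker), φ (Ψ a) = 0 := by
    have h1 := hstrict.map_implicitFunction_eq hrange
    have h2 : Filter.Tendsto (fun a : f'.ker => (φ x₀, a)) (nhds 0) (nhds (φ x₀, 0)) :=
      (continuous_const.prodMk continuous_id).tendsto 0
    filter_upwards [h2.eventually h1] with a ha
    rw [← hzero]
    exact ha
  obtain ⟨R, hR, hball⟩ := Metric.eventually_nhds_iff_ball.1
    ((Filter.eventually_mem_set.2 hs).and (hlevel.and (hΨc.eventually (hU.mem_nhds hxU))))
  have hΨbil : ∀ a ∈ ball (0 : f'.ker) R, ∀ b ∈ ball (0 : f'.ker) R,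
      dist (Ψ a) (Ψ b) ≤ 2 * dist a b ∧ dist a b ≤ 2 * dist (Ψ a) (Ψ b) := by
    intro a ha b hb
    have h1 := happ a (hball a ha).1 b (hball b hb).1
    have h2 : ‖f'.ker.subtypeL (a - b)‖ = ‖a - b‖ := rfl
    simp only [NNReal.coe_div, NNReal.coe_one, NNReal.coe_ofNat] at h1
    rw [dist_eq_norm, dist_eq_norm]
    have h3 := norm_sub_norm_le (Ψ a - Ψ b) (f'.ker.subtypeL (a - b))
    have h4 := norm_sub_norm_le (f'.ker.subtypeL (a - b)) (Ψ a - Ψ b)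
    rw [norm_sub_rev (f'.ker.subtypeL (a - b))] at h4
    have h5 : ‖Ψ a - Ψ b - f'.ker.subtypeL (a - b)‖ ≤ 1 / 2 * ‖a - b‖ := h1
    have := norm_nonneg (a - b)
    constructor <;> linarith
  have hHc : Filter.Tendsto (fun x => (H x).2) (nhds x₀) (nhds 0) := by
    have h1 : ContinuousAt H x₀ :=
      H.continuousAt (hstrict.mem_implicitToOpenPartialHomeomorph_source hrange)
    have h2 := (continuous_snd.tendsto _).comp h1.tendsto
    rwa [hH, hstrict.implicitToOpenPartialHomeomorph_self hrange] at h2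
  have hev : ∀ᶠ x in nhds x₀, x ∈ U ∧ (H x).2 ∈ ball (0 : f'.ker) (R / 2) ∧
      hstrict.implicitFunction φ f' hrange (φ x) (H x).2 = x :=
    (hU.eventually_mem hxU).and ((hHc.eventually (ball_mem_nhds 0 (by positivity))).and
      (hstrict.eq_implicitFunction hrange))
  obtain ⟨δ, hδ, hδball⟩ := Metric.eventually_nhds_iff_ball.1 hev
  have hrep : ∀ x ∈ M, x ∈ ball x₀ δ → Ψ (H x).2 = x := by
    intro x hxM hx
    obtain ⟨hxU', -, h⟩ := hδball x hx
    rw [(hmemM x hxU').1 hxM, ← hzero] at h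
    exact h
  -- The bound `R / 4` keeps the translated parameters inside the ball of radius `R`. The bound `δ`
  -- keeps points within half the chart radius of `x` inside the ball of radius `δ` about `x₀`.
  refine ⟨ball x₀ (δ / 2), ball_mem_nhds _ (by positivity), min (R / 4) δ, by positivity, ?_⟩
  intro x hxM hx
  have hxδ : x ∈ ball x₀ δ := ball_subset_ball (by linarith) hx
  set c := (H x).2 with hc
  have hcR : ‖c‖ < R / 2 := by simpa using (hδball x hxδ).2.1
  have hin : ∀ a ∈ closedBall (0 : Pt (d - 1)) (min (R / 4) δ), c + ι a ∈ ball (0 : f'.ker) R := by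
    intro a ha
    rw [mem_closedBall_zero_iff] at ha
    rw [mem_ball_zero_iff]
    have h1 := norm_add_le c (ι a)
    rw [ι.norm_map] at h1
    have := ha.trans (min_le_left _ _)
    linarith
  refine ⟨fun a => Ψ (c + ι a), ?_, fun a ha => ?_, fun a ha b hb => ?_, fun y hy hyx => ?_⟩
  · simpa using hrep x hxM hxδ
  · obtain ⟨-, h1, h2⟩ := hball _ (hin a ha)
    exact (hmemM _ h2).2 h1
  · have h1 := hΨbil _ (hin a ha) _ (hin b hb)
    rwa [dist_add_left, ι.dist_map] at h1
  · have hyδ : y ∈ ball x₀ δ := by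
      have h1 := dist_triangle y x x₀
      have h2 := min_le_right (R / 4) δ
      rw [mem_ball] at hx ⊢
      linarith
    have hyR : ‖(H y).2‖ < R / 2 := by simpa using (hδball y hyδ).2.1
    have hsum : c + ι (ι.symm ((H y).2 - c)) = (H y).2 := by simp
    refine ⟨ι.symm ((H y).2 - c), ?_, ?_⟩
    · rw [mem_closedBall_zero_iff, ι.symm.norm_map, ← dist_eq_norm]
      have h1 := (hΨbil (H y).2 (by rw [mem_ball_zero_iff]; linarith) c
        (by rw [mem_ball_zero_iff]; linarith)).2
      rwa [hrep y hy hyδ, hrep x hxM hxδ] at h1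
    · simp only [hsum]
      exact hrep y hy hyδ

theorem exists_chartsOn {M : Set (Pt d)} (hM : IsCompactC1Hypersurface M) :
    ∃ r > 0, HasChartsOn Set.univ M r := by
  have key : ∃ r > 0, HasChartsOn M M r := by
    refine hM.isCompact.induction_on (p := fun A => ∃ r > 0, HasChartsOn A M r) ?_ ?_ ?_ ?_
    · exact ⟨1, one_pos, fun x _ hx => hx.elim⟩
    · rintro A B hAB ⟨r, hr, h⟩
      exact ⟨r, hr, h.mono hAB le_rfl⟩
    · rintro A B ⟨r, hr, h⟩ ⟨s, hs, h'⟩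
      refine ⟨min r s, lt_min hr hs, fun x hx hxAB => ?_⟩
      rcases hxAB with hxA | hxB
      · exact h.mono subset_rfl (min_le_left r s) x hx hxA
      · exact h'.mono subset_rfl (min_le_right r s) x hx hxB
    · intro x hx
      obtain ⟨V, hV, r, hr, h⟩ := exists_chartsOn_nhds hM hx
      exact ⟨V, mem_nhdsWithin_of_mem_nhds hV, r, hr, h⟩
  obtain ⟨r, hr, h⟩ := key
  exact ⟨r, hr, fun x hx _ => h x hx hx⟩

theorem euclideanHausdorffMeasure_image_le {X Y : Type*} [MetricSpace X] [MeasurableSpace X]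
    [BorelSpace X] [MetricSpace Y] [MeasurableSpace Y] [BorelSpace Y] {K : NNReal} {f : X → Y}
    {s : Set X} (h : LipschitzOnWith K f s) (m : ℕ) :
    μHE[m] (f '' s) ≤ (K : ENNReal) ^ m * μHE[m] s := by
  have h1 := h.hausdorffMeasure_image_le (d := (m : ℝ)) (Nat.cast_nonneg m)
  simp only [Measure.euclideanHausdorffMeasure_def, Measure.smul_apply, ENNReal.smul_def,
    smul_eq_mul]
  rw [ENNReal.rpow_natCast] at h1
  calc _ ≤ _ * ((K : ENNReal) ^ m * μH[m] s) := mul_le_mul_right h1 _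
    _ = _ := by ring

theorem volume_closedBall_Pt (m : ℕ) (a : Pt m) {r : ℝ} (hr : 0 ≤ r) :
    (μHE[m] : Measure (Pt m)) (closedBall a r) =
      ENNReal.ofReal (r ^ m * (volume (ball (0 : Pt m) 1)).toReal) := by
  rw [EuclideanSpace.euclideanHausdorffMeasure_eq_volume, Measure.addHaar_closedBall volume a hr,
    finrank_euclideanSpace_fin, ENNReal.ofReal_mul (by positivity),
    ENNReal.ofReal_toReal measure_ball_lt_top.ne]

/-- The inverse chart is `2`-Lipschitz and maps the image back onto the ball. This is the source of
the lower bound for the area of the interface near a point. -/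
theorem le_measure_image_closedBall {Φ : Pt (d - 1) → Pt d} {r : ℝ} (hr : 0 ≤ r)
    (hΦ : ∀ a ∈ closedBall 0 r, ∀ b ∈ closedBall 0 r, dist a b ≤ 2 * dist (Φ a) (Φ b)) :
    ENNReal.ofReal (r ^ (d - 1) * (volume (ball (0 : Pt (d - 1)) 1)).toReal) ≤
      2 ^ (d - 1) * μHE[d - 1] (Φ '' closedBall 0 r) := by
  have hinj : Set.InjOn Φ (closedBall 0 r) := fun a ha b hb hab => by
    have := hΦ a ha b hb
    rw [hab, dist_self, mul_zero] at this
    exact dist_le_zero.1 this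
  have hLip : LipschitzOnWith 2 (Function.invFunOn Φ (closedBall 0 r)) (Φ '' closedBall 0 r) := by
    refine LipschitzOnWith.of_dist_le_mul ?_
    rintro _ ⟨a, ha, rfl⟩ _ ⟨b, hb, rfl⟩
    rw [hinj.leftInvOn_invFunOn ha, hinj.leftInvOn_invFunOn hb]
    exact hΦ a ha b hb
  have h1 := euclideanHausdorffMeasure_image_le hLip (d - 1)
  rw [hinj.leftInvOn_invFunOn.image_image, volume_closedBall_Pt _ _ hr] at h1
  simpa using h1

theorem HasChartsOn.measure_inter_closedBall_le {S : Set (Pt d)} {r₀ : ℝ}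
    (h : HasChartsOn Set.univ S r₀) {x : Pt d} (hx : x ∈ S) {r : ℝ} (hr : 0 ≤ r)
    (hr0 : r ≤ r₀ / 2) :
    μHE[d - 1] (S ∩ closedBall x r) ≤
      ENNReal.ofReal (4 ^ (d - 1) * (volume (ball (0 : Pt (d - 1)) 1)).toReal * r ^ (d - 1)) := by
  obtain ⟨Φ, -, -, h2, h3⟩ := h x hx trivial
  have hsub : S ∩ closedBall x r ⊆ Φ '' closedBall 0 (2 * r) := by
    rintro y ⟨hy, hyx⟩
    rw [mem_closedBall] at hyx
    obtain ⟨a, ha, rfl⟩ := h3 y hy (hyx.trans hr0)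
    exact ⟨a, closedBall_subset_closedBall (by linarith) ha, rfl⟩
  have hcb : closedBall (0 : Pt (d - 1)) (2 * r) ⊆ closedBall 0 r₀ :=
    closedBall_subset_closedBall (by linarith)
  have hLip : LipschitzOnWith 2 Φ (closedBall 0 (2 * r)) :=
    LipschitzOnWith.of_dist_le_mul fun a ha b hb => (h2 a (hcb ha) b (hcb hb)).1
  refine (measure_mono hsub).trans ((euclideanHausdorffMeasure_image_le hLip (d - 1)).trans_eq ?_)
  rw [volume_closedBall_Pt _ _ (by linarith)]
  have : ((2 : NNReal) : ENNReal) = ENNReal.ofReal 2 := by simp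
  rw [this, ← ENNReal.ofReal_pow (by norm_num), ← ENNReal.ofReal_mul (by positivity)]
  congr 1
  rw [show (4 : ℝ) = 2 * 2 by norm_num, mul_pow, mul_pow]
  ring

/-- The surface measure of the part of a compact hypersurface in a ball of radius `r` is
`O(r^(d-1))`. -/
theorem exists_measure_inter_closedBall_le {M : Set (Pt d)} (hM : IsCompactC1Hypersurface M) :
    ∃ C : ℝ, 0 ≤ C ∧ ∀ (g : Pt d ≃ᵃⁱ[ℝ] Pt d), ∀ x ∈ g '' M, ∀ r : ℝ, 0 ≤ r →
      μHE[d - 1] (g '' M ∩ closedBall x r) ≤ ENNReal.ofReal (C * r ^ (d - 1)) := by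
  obtain ⟨r₀, hr₀, hch⟩ := exists_chartsOn hM
  have hfin : μHE[d - 1] M < ⊤ := by
    refine hM.isCompact.measure_lt_top_of_nhdsWithin fun x hx => ?_
    refine ⟨M ∩ closedBall x (r₀ / 2),
      Filter.inter_mem self_mem_nhdsWithin (mem_nhdsWithin_of_mem_nhds
        (closedBall_mem_nhds x (by positivity))), ?_⟩
    exact (hch.measure_inter_closedBall_le hx (by positivity) le_rfl).trans_lt
      ENNReal.ofReal_lt_top
  set C₁ := 4 ^ (d - 1) * (volume (ball (0 : Pt (d - 1)) 1)).toReal with hC₁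
  set C₂ := (μHE[d - 1] M).toReal / (r₀ / 2) ^ (d - 1) with hC₂
  have h1 : 0 ≤ C₁ := by positivity
  have h2 : 0 ≤ C₂ := by positivity
  refine ⟨C₁ + C₂, by positivity, ?_⟩
  rintro g _ ⟨x, hx, rfl⟩ r hr
  have him : g '' M ∩ closedBall (g x) r = g '' (M ∩ closedBall x r) := by
    ext y
    constructor
    · rintro ⟨⟨y, hy, rfl⟩, h⟩
      exact ⟨y, ⟨hy, by simpa [g.dist_map] using h⟩, rfl⟩
    · rintro ⟨y, ⟨hy, h⟩, rfl⟩
      exact ⟨⟨y, hy, rfl⟩, by simpa [g.dist_map] using h⟩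
  rw [him, g.isometry.euclideanHausdorffMeasure_image]
  have hrp : 0 ≤ r ^ (d - 1) := by positivity
  -- Small radii are handled by a chart; for large radii the total area, finite by compactness, is
  -- already `O(r^(d-1))`.
  rcases le_total r (r₀ / 2) with hle | hle
  · refine (hch.measure_inter_closedBall_le hx hr hle).trans (ENNReal.ofReal_le_ofReal ?_)
    exact mul_le_mul_of_nonneg_right (by linarith) hrp
  · refine (measure_mono Set.inter_subset_left).trans ?_
    rw [← ENNReal.ofReal_toReal hfin.ne]
    refine ENNReal.ofReal_le_ofReal ?_
    calc (μHE[d - 1] M).toReal = C₂ * (r₀ / 2) ^ (d - 1) := by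
          rw [hC₂, div_mul_cancel₀ _ (by positivity)]
      _ ≤ C₂ * r ^ (d - 1) := by gcongr
      _ ≤ (C₁ + C₂) * r ^ (d - 1) := mul_le_mul_of_nonneg_right (by linarith) hrp

end Hypersurfaces

/-! ### Estimates for finite element functions on single elements. -/

namespace Triangulation

variable {d k : ℕ} {Ω : Set (Pt d)} {𝒯 : Triangulation Ω} {σ : ℝ}

theorem exists_polyFun_eqOn {v : Pt d → ℝ} {T : Finset (Pt d)} (hv : IsPolynomialOn k v T) :
    ∃ p : MvPolynomial (Fin d) ℝ, p.totalDegree ≤ k ∧ Set.EqOn v (polyFun p) (simplex T) := hv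

theorem ae_eq_interior_simplex (T : Finset (Pt d)) :
    (interior (simplex T) : Set (Pt d)) =ᵐ[volume] simplex T :=
  interior_ae_eq_of_null_frontier ((convex_simplex T).addHaar_frontier volume)

theorem gradient_eqOn_interior {v f : Pt d → ℝ} {T : Set (Pt d)} (h : Set.EqOn v f T) :
    Set.EqOn (gradient v) (gradient f) (interior T) := fun x hx => by
  have : v =ᶠ[nhds x] f := Filter.eventuallyEq_of_mem (mem_interior_iff_mem_nhds.1 hx) h
  simp only [gradient, this.fderiv_eq]

theorem setIntegral_gradient_sq {v : Pt d → ℝ} {T : Finset (Pt d)}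
    {p : MvPolynomial (Fin d) ℝ} (h : Set.EqOn v (polyFun p) (simplex T)) :
    ∫ x in simplex T, ‖gradient v x‖ ^ 2 = ∫ x in simplex T, ‖polyGrad p x‖ ^ 2 := by
  rw [← setIntegral_congr_set (ae_eq_interior_simplex T),
    ← setIntegral_congr_set (ae_eq_interior_simplex T)]
  refine setIntegral_congr_fun isOpen_interior.measurableSet fun x hx => ?_
  simp only [gradient_eqOn_interior h hx, (hasGradientAt_polyFun p x).gradient]

theorem integrableOn_gradient_sq {v : Pt d → ℝ} {T : Finset (Pt d)}
    (hv : IsPolynomialOn k v T) :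
    IntegrableOn (fun x => ‖gradient v x‖ ^ 2) (interior (simplex T)) := by
  obtain ⟨p, -, h⟩ := exists_polyFun_eqOn hv
  have h1 : IntegrableOn (fun x => ‖polyGrad p x‖ ^ 2) (interior (simplex T)) :=
    (((continuous_polyGrad p).norm.pow 2).continuousOn.integrableOn_compact
      (isCompact_simplex T)).mono_set interior_subset
  refine h1.congr_fun (fun x hx => ?_) isOpen_interior.measurableSet
  simp only [gradient_eqOn_interior h hx, (hasGradientAt_polyFun p x).gradient]

theorem mem_cutElements {Γ : Set (Pt d)} {T : Finset (Pt d)} :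
    T ∈ 𝒯.cutElements Γ ↔ T ∈ 𝒯.elements ∧ (simplex T ∩ Γ).Nonempty := by
  simp [cutElements]

/-- Interiors of distinct elements are disjoint and boundaries of convex sets are null, so the
integral over the strip splits. -/
theorem gradStripNormSq_eq {Γ : Set (Pt d)} {v : Pt d → ℝ}
    (hv : ∀ T ∈ 𝒯.elements, IsPolynomialOn k v T) :
    𝒯.gradStripNormSq Γ v = ∑ T ∈ 𝒯.cutElements Γ, ∫ x in simplex T, ‖gradient v x‖ ^ 2 := by
  have hsub : ∀ T ∈ 𝒯.cutElements Γ, T ∈ 𝒯.elements := fun T hT => (mem_cutElements.1 hT).1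
  have h1 : (⋃ T ∈ 𝒯.cutElements Γ, interior (simplex T) : Set (Pt d)) =ᵐ[volume]
      ⋃ T ∈ 𝒯.cutElements Γ, simplex T :=
    Filter.EventuallyEq.countable_bUnion (𝒯.cutElements Γ).countable_toSet
      fun T _ => ae_eq_interior_simplex T
  rw [gradStripNormSq, strip, ← setIntegral_congr_set h1, integral_biUnion_finset]
  · exact Finset.sum_congr rfl fun T _ => setIntegral_congr_set (ae_eq_interior_simplex T)
  · exact fun T _ => isOpen_interior.measurableSet
  · exact fun T hT T' hT' hne => disjoint_interior (hsub T hT) (hsub T' hT') hne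
  · exact fun T hT => integrableOn_gradient_sq (hv T (hsub T hT))

/-- Scaled estimates for polynomials on the elements of a shape regular triangulation. -/
theorem exists_element_estimates (hd : 0 < d) (k : ℕ) (hσ1 : 1 ≤ σ) :
    ∃ C : ℝ, 0 ≤ C ∧ ∀ (Ω : Set (Pt d)) (𝒯 : Triangulation Ω), 𝒯.IsShapeRegular σ →
      ∀ T ∈ 𝒯.elements, ∀ v : Pt d → ℝ, IsPolynomialOn k v T →
        (∀ y ∈ simplex T, v y ^ 2 ≤ C * (meshSize T ^ d)⁻¹ * ∫ x in simplex T, v x ^ 2) ∧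
        (∫ x in simplex T, ‖gradient v x‖ ^ 2 ≤
          C * (meshSize T ^ 2)⁻¹ * ∫ x in simplex T, v x ^ 2) ∧
        (∀ x ∈ simplex T, ∀ y ∈ simplex T, |v x - v y| ≤
          √(C * (meshSize T ^ d)⁻¹ * ∫ x in simplex T, ‖gradient v x‖ ^ 2) * dist x y) ∧
        volume.real (simplex T) ≤ C * meshSize T ^ d := by
  obtain ⟨C₀, hC₀, hest⟩ := exists_polynomial_estimates d k σ
  have hσ0 : 0 < σ := by linarith
  set ω := (volume (ball (0 : Pt d) 1)).toReal with hω
  have hω0 : 0 ≤ ω := ENNReal.toReal_nonneg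
  -- The three terms serve the pointwise bounds, the volume bound and the inverse inequality,
  -- respectively.
  set C := C₀ * σ ^ d + ω * σ ^ d + C₀ * σ ^ (d + 2) * (ω * σ ^ d) with hC
  have hCa : C₀ * σ ^ d ≤ C := by
    have : 0 ≤ ω * σ ^ d + C₀ * σ ^ (d + 2) * (ω * σ ^ d) := by positivity
    linarith
  have hCb : ω * σ ^ d ≤ C := by
    have : 0 ≤ C₀ * σ ^ d + C₀ * σ ^ (d + 2) * (ω * σ ^ d) := by positivity
    linarith
  have hCc : C₀ * σ ^ (d + 2) * (ω * σ ^ d) ≤ C := by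
    have : 0 ≤ C₀ * σ ^ d + ω * σ ^ d := by positivity
    linarith
  have hC0 : 0 ≤ C := by positivity
  refine ⟨C, hC0, fun Ω 𝒯 hσ T hT v hv => ?_⟩
  obtain ⟨z, ρ, hρ, hball, hsub, hle, hm⟩ := exists_ball hd hσ hT
  obtain ⟨p, hp, hvp⟩ := exists_polyFun_eqOn hv
  set h := meshSize T with hh
  have hh0 : 0 < h := meshSize_pos hd hσ hT
  have hTm : MeasurableSet (simplex T) := (isCompact_simplex T).isClosed.measurableSet
  have hvol : volume.real (simplex T) ≤ ω * σ ^ d * h ^ d := by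
    have h1 : volume.real (simplex T) ≤ volume.real (closedBall z (σ * ρ)) :=
      measureReal_mono hsub measure_closedBall_lt_top.ne
    have h2 : volume.real (closedBall z (σ * ρ)) = (σ * ρ) ^ d * ω := by
      rw [Measure.real, Measure.addHaar_closedBall volume z (by positivity), ENNReal.toReal_mul,
        ENNReal.toReal_ofReal (by positivity), finrank_euclideanSpace_fin]
    have h3 : (σ * ρ) ^ d ≤ (σ * h) ^ d := by gcongr
    calc _ ≤ (σ * h) ^ d * ω := h1.trans (h2.trans_le (mul_le_mul_of_nonneg_right h3 hω0))
      _ = _ := by rw [mul_pow]; ring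
  have hinv : ∀ n : ℕ, (ρ ^ n)⁻¹ ≤ σ ^ n * (h ^ n)⁻¹ := fun n => by
    rw [← div_eq_mul_inv, inv_eq_one_div, div_le_div_iff₀ (by positivity) (by positivity), one_mul,
      ← mul_pow]
    exact pow_le_pow_left₀ hh0.le hm n
  have hmono : ∀ f : Pt d → ℝ, Continuous f → (∀ x, 0 ≤ f x) →
      0 ≤ ∫ x in closedBall z ρ, f x ∧
      ∫ x in closedBall z ρ, f x ≤ ∫ x in simplex T, f x := fun f hf hf0 =>
    ⟨integral_nonneg hf0, setIntegral_mono_set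
      (hf.continuousOn.integrableOn_compact (isCompact_simplex T))
      (Filter.Eventually.of_forall hf0) (LE.le.eventuallyLE hball)⟩
  have hgrad := setIntegral_gradient_sq hvp
  have hval : ∫ x in simplex T, v x ^ 2 = ∫ x in simplex T, polyFun p x ^ 2 :=
    setIntegral_congr_fun hTm fun x hx => by simp only [hvp hx]
  rw [hgrad, hval]
  obtain ⟨hE0, hE⟩ := hmono (fun x => polyFun p x ^ 2) ((continuous_polyFun p).pow 2)
    fun x => sq_nonneg _
  obtain ⟨hD0, hD⟩ := hmono (fun x => ‖polyGrad p x‖ ^ 2) ((continuous_polyGrad p).norm.pow 2)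
    fun x => sq_nonneg _
  set E := ∫ x in simplex T, polyFun p x ^ 2 with hEdef
  set D := ∫ x in simplex T, ‖polyGrad p x‖ ^ 2 with hDdef
  have hE0' : 0 ≤ E := hE0.trans hE
  have hD0' : 0 ≤ D := hD0.trans hD
  have hscale : ∀ I J : ℝ, 0 ≤ I → I ≤ J →
      C₀ * ((ρ ^ d)⁻¹ * I) ≤ C * (h ^ d)⁻¹ * J := fun I J hI hIJ => by
    calc C₀ * ((ρ ^ d)⁻¹ * I) ≤ C₀ * ((σ ^ d * (h ^ d)⁻¹) * J) := by
          gcongr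
          exact hinv d
      _ = (C₀ * σ ^ d) * ((h ^ d)⁻¹ * J) := by ring
      _ ≤ C * ((h ^ d)⁻¹ * J) := by
          have : 0 ≤ J := hI.trans hIJ
          gcongr
      _ = _ := by ring
  have hgle : ∀ y ∈ simplex T, ‖polyGrad p y‖ ≤ √(C * (h ^ d)⁻¹ * D) := fun y hy => by
    refine Real.le_sqrt_of_sq_le ?_
    exact (hest p z ρ hp hρ y (hsub hy)).2.2.trans (hscale _ _ hD0 hD)
  refine ⟨fun y hy => ?_, ?_, fun x hx y hy => ?_, ?_⟩
  · rw [hvp hy]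
    exact (hest p z ρ hp hρ y (hsub hy)).1.trans (hscale _ _ hE0 hE)
  · have hpt : ∀ y ∈ simplex T, ‖polyGrad p y‖ ^ 2 ≤ C₀ * σ ^ (d + 2) * (h ^ (d + 2))⁻¹ * E := by
      intro y hy
      have h1 := (hest p z ρ hp hρ y (hsub hy)).2.1
      rw [← le_div_iff₀' (by positivity)] at h1
      calc ‖polyGrad p y‖ ^ 2 ≤ _ := h1
        _ = C₀ * (ρ ^ (d + 2))⁻¹ * ∫ x in closedBall z ρ, polyFun p x ^ 2 := by
            rw [pow_add]; field_simp
        _ ≤ C₀ * (σ ^ (d + 2) * (h ^ (d + 2))⁻¹) * E := by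
            gcongr
            exact hinv (d + 2)
        _ = _ := by ring
    have h2 : ‖D‖ ≤ C₀ * σ ^ (d + 2) * (h ^ (d + 2))⁻¹ * E * volume.real (simplex T) :=
      norm_setIntegral_le_of_norm_le_const (isCompact_simplex T).measure_lt_top
        fun y hy => by
          rw [Real.norm_of_nonneg (sq_nonneg _)]
          exact hpt y hy
    rw [Real.norm_of_nonneg hD0'] at h2
    calc D ≤ C₀ * σ ^ (d + 2) * (h ^ (d + 2))⁻¹ * E * (ω * σ ^ d * h ^ d) := by
          refine h2.trans ?_
          gcongr
      _ = (C₀ * σ ^ (d + 2) * (ω * σ ^ d)) * ((h ^ 2)⁻¹ * E) := by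
          simp only [pow_add]; field_simp
      _ ≤ C * ((h ^ 2)⁻¹ * E) := by gcongr
      _ = _ := by ring
  · rw [hvp hx, hvp hy, dist_eq_norm, ← Real.norm_eq_abs]
    refine (convex_simplex T).norm_image_sub_le_of_norm_hasFDerivWithin_le
      (fun w _ => (hasGradientAt_polyFun p w).hasFDerivAt.hasFDerivWithinAt) (fun w hw => ?_) hy hx
    rw [LinearIsometryEquiv.norm_map]
    exact hgle w hw
  · exact hvol.trans (mul_le_mul_of_nonneg_right hCb (by positivity))

/-! ### Control of interface values by norms on nearby cut elements. -/

open scoped Classical in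
/-- The cut elements in the patch of `T`. -/
noncomputable def cutPatch (𝒯 : Triangulation Ω) (Γ : Set (Pt d)) (T : Finset (Pt d)) :
    Finset (Finset (Pt d)) :=
  (𝒯.cutElements Γ).filter fun T' => T' ∈ 𝒯.patch T

theorem mem_cutPatch {Γ : Set (Pt d)} {T T' : Finset (Pt d)} :
    T' ∈ 𝒯.cutPatch Γ T ↔ T' ∈ 𝒯.cutElements Γ ∧ T' ∈ 𝒯.patch T := by
  simp [cutPatch]

/-- Variation of a finite element function along a short path in the interface. -/
theorem path_estimate (hd : 2 ≤ d) (hσ : 𝒯.IsShapeRegular σ) (hσ1 : 1 ≤ σ)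
    (hΩ : IsOpen Ω) {Γ : Set (Pt d)} {T : Finset (Pt d)} (hT : T ∈ 𝒯.elements) {v : Pt d → ℝ}
    {C₁ : ℝ} (hC₁ : 0 ≤ C₁)
    (hLip : ∀ S ∈ 𝒯.elements, ∀ x ∈ simplex S, ∀ y ∈ simplex S, |v x - v y| ≤
      √(C₁ * (meshSize S ^ d)⁻¹ * ∫ x in simplex S, ‖gradient v x‖ ^ 2) * dist x y)
    {γ : ℝ → Pt d} {ℓ b : ℝ} (hb : 0 < b) (hℓ : 0 ≤ ℓ)
    (hγ : ∀ s ∈ Set.Icc 0 b, ∀ t ∈ Set.Icc 0 b, dist (γ s) (γ t) ≤ ℓ * |s - t|)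
    (hγΩ : ∀ t ∈ Set.Ico 0 b, γ t ∈ Ω ∩ Γ) (hγ0 : γ 0 ∈ simplex T)
    (hlen : σ * patchRatio d σ * (ℓ * b) < meshSize T) :
    (∀ t ∈ Set.Icc 0 b, ∃ T' ∈ 𝒯.cutPatch Γ T, γ t ∈ simplex T') ∧
      |v (γ b) - v (γ 0)| ≤ √(C₁ * patchRatio d σ ^ d * (meshSize T ^ d)⁻¹ *
        ∑ S ∈ 𝒯.cutPatch Γ T, ∫ x in simplex S, ‖gradient v x‖ ^ 2) * ℓ * b := by
  have hd0 : 0 < d := by omega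
  have hσ0 : 0 < σ := by linarith
  have hK1 : 1 ≤ patchRatio d σ := one_le_patchRatio hσ1
  have hT0 := meshSize_pos hd0 hσ hT
  have hcont : ContinuousOn γ (Set.Icc 0 b) := by
    refine (LipschitzOnWith.of_dist_le_mul (K := ⟨ℓ, hℓ⟩) fun s hs t ht => ?_).continuousOn
    rw [Real.dist_eq]
    exact hγ s hs t ht
  -- The end point `γ b` may lie on `∂Ω`, so the argument is run up to each `t < b`; closedness of
  -- the elements then adds `t = b`.
  have hIco : ∀ t ∈ Set.Ico 0 b, ∃ T' ∈ 𝒯.cutPatch Γ T, γ t ∈ simplex T' := by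
    intro t ht
    have hsub : Set.Icc 0 t ⊆ Set.Ico 0 b := Set.Icc_subset_Ico_right ht.2
    obtain ⟨T', hT', hmem⟩ := exists_mem_patch_of_path hd hσ hσ1 hΩ hT (b := t) hℓ
      (fun s hs u hu => hγ s (Set.Ico_subset_Icc_self (hsub hs)) u
        (Set.Ico_subset_Icc_self (hsub hu)))
      (fun s hs => (hγΩ s (hsub hs)).1) hγ0
      (lt_of_le_of_lt (by have := ht.2.le; gcongr) hlen) t ⟨ht.1, le_rfl⟩
    exact ⟨T', mem_cutPatch.2 ⟨mem_cutElements.2 ⟨mem_elements_of_mem_patch hT',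
      γ t, hmem, (hγΩ t ht).2⟩, hT'⟩, hmem⟩
  have hIcc : ∀ t ∈ Set.Icc 0 b, ∃ T' ∈ 𝒯.cutPatch Γ T, γ t ∈ simplex T' := by
    have hcl : IsClosed (⋃ S ∈ 𝒯.cutPatch Γ T, simplex S) :=
      (𝒯.cutPatch Γ T).finite_toSet.isClosed_biUnion fun S _ => (isCompact_simplex S).isClosed
    have hQ := hcont.preimage_isClosed_of_isClosed isClosed_Icc hcl
    intro t ht
    rw [← closure_Ico hb.ne] at ht
    have := (hQ.closure_subset_iff.2 (fun s hs => ⟨Set.Ico_subset_Icc_self hs, by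
      simpa using hIco s hs⟩) ht).2
    simpa using this
  refine ⟨hIcc, ?_⟩
  set D : Finset (Pt d) → ℝ := fun S => ∫ x in simplex S, ‖gradient v x‖ ^ 2 with hD
  have hD0 : ∀ S, 0 ≤ D S := fun S => integral_nonneg fun x => sq_nonneg _
  have := abs_sub_le_of_path (f := v) (γ := γ) (S := simplex) (Real.sqrt_nonneg
    (C₁ * patchRatio d σ ^ d * (meshSize T ^ d)⁻¹ * ∑ S ∈ 𝒯.cutPatch Γ T, D S)) hℓ
    (𝒯.cutPatch Γ T) hb.le (fun S _ => (isCompact_simplex S).isClosed) hγ hIcc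
    (fun S hS x hx y hy => by
      have hSp := (mem_cutPatch.1 hS).2
      have hSe := mem_elements_of_mem_patch hSp
      refine (hLip S hSe x hx y hy).trans (mul_le_mul_of_nonneg_right ?_ dist_nonneg)
      refine Real.sqrt_le_sqrt ?_
      have hS0 := meshSize_pos hd0 hσ hSe
      have h1 : (meshSize S ^ d)⁻¹ ≤ patchRatio d σ ^ d * (meshSize T ^ d)⁻¹ := by
        rw [← div_eq_mul_inv, inv_eq_one_div, div_le_div_iff₀ (by positivity) (by positivity),
          one_mul, ← mul_pow]
        exact pow_le_pow_left₀ hT0.le (meshSize_patch hd hσ hσ1 hΩ hT hSp).2 d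
      have h2 : D S ≤ ∑ S ∈ 𝒯.cutPatch Γ T, D S := Finset.single_le_sum (fun S _ => hD0 S) hS
      rw [mul_assoc C₁ (patchRatio d σ ^ d)]
      have := hD0 S
      gcongr)
  rwa [sub_zero] at this

theorem integrableOn_sq_of_subset {μ : Measure (Pt d)} {v : Pt d → ℝ} {T : Finset (Pt d)}
    (hv : IsPolynomialOn k v T) {A : Set (Pt d)} (hA : MeasurableSet A) (hAT : A ⊆ simplex T)
    (hμ : μ A < ⊤) : IntegrableOn (fun x => v x ^ 2) A μ := by
  obtain ⟨p, -, hvp⟩ := exists_polyFun_eqOn hv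
  have hc : Continuous fun x => polyFun p x ^ 2 := (continuous_polyFun p).pow 2
  obtain ⟨B, hB⟩ := (isCompact_simplex T).exists_bound_of_continuousOn hc.continuousOn
  have h1 : IntegrableOn (fun x => polyFun p x ^ 2) A μ :=
    Measure.integrableOn_of_bounded (M := B) hμ.ne hc.aestronglyMeasurable
      ((ae_restrict_iff' hA).2 (Filter.Eventually.of_forall fun x hx => hB x (hAT hx)))
  exact h1.congr_fun (fun x hx => by simp only [hvp (hAT hx)]) hA

set_option maxHeartbeats 800000 in
/-- The value of a finite element function at an interface point in a cut element is controlled by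
the norms on nearby cut elements. -/
theorem exists_local_estimate (hd : 2 ≤ d) (k : ℕ) (hσ1 : 1 ≤ σ) {M : Set (Pt d)}
    (hM : IsCompactC1Hypersurface M) {C₁ : ℝ} (hC₁ : 0 ≤ C₁) {δ : ℝ} (hδ : 0 < δ) :
    ∃ C : ℝ, 0 ≤ C ∧ ∀ (Ω : Set (Pt d)) (𝒯 : Triangulation Ω) (g : Pt d ≃ᵃⁱ[ℝ] Pt d)
      (Γ : Set (Pt d)), IsOpen Ω → 𝒯.IsShapeRegular σ → IsClosed Γ → Γ ⊆ g '' M →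
      g '' M ∩ Ω ⊆ Γ → (∀ T ∈ 𝒯.elements, meshSize T ≤ δ) →
      ∀ v : Pt d → ℝ, (∀ T ∈ 𝒯.elements, IsPolynomialOn k v T) → (∀ x ∈ frontier Ω, v x = 0) →
      (∀ S ∈ 𝒯.elements, ∀ x ∈ simplex S, ∀ y ∈ simplex S, |v x - v y| ≤
        √(C₁ * (meshSize S ^ d)⁻¹ * ∫ x in simplex S, ‖gradient v x‖ ^ 2) * dist x y) →
      ∀ T ∈ 𝒯.cutElements Γ, ∃ x ∈ simplex T, meshSize T ^ d * (meshSize T ^ 2)⁻¹ * v x ^ 2 ≤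
        C * ∑ S ∈ 𝒯.cutPatch Γ T, ((meshSize S)⁻¹ * (∫ x in simplex S ∩ Γ, v x ^ 2 ∂μHE[d - 1]) +
          ∫ x in simplex S, ‖gradient v x‖ ^ 2) := by
  obtain ⟨r₀, hr₀, hch⟩ := exists_chartsOn hM
  obtain ⟨CM, hCM, hmeas⟩ := exists_measure_inter_closedBall_le hM
  have hd0 : 0 < d := by omega
  have hσ0 : 0 < σ := by linarith
  set K := patchRatio d σ with hK
  have hK1 : 1 ≤ K := one_le_patchRatio hσ1
  have hK0 : 0 < K := by linarith
  set ω := (volume (ball (0 : Pt (d - 1)) 1)).toReal with hω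
  have hω0 : 0 < ω := ENNReal.toReal_pos (measure_ball_pos volume _ one_pos).ne'
    measure_ball_lt_top.ne
  -- With `r ≤ c h`, rays of length at most `2 r` satisfy `σ K · 2 r ≤ h / 2 < h`, as
  -- `path_estimate` requires.
  set c := 1 / (4 * (σ * K)) with hc
  have hc0 : 0 < c := by positivity
  have hc1 : c ≤ 1 := by
    rw [hc, div_le_one (by positivity)]
    nlinarith
  -- The chart radius is `min (c h) r₀`. Since `h ≤ δ`, it is at least `c' h`, so it stays
  -- comparable with `h` on coarse meshes too.
  set c' := min c (r₀ / δ) with hc'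
  have hc'0 : 0 < c' := lt_min hc0 (by positivity)
  set Ca := 8 * (C₁ * K ^ d) with hCa
  set Cb := 2 * (2 ^ (d - 1) / (c' ^ (d - 1) * ω) * K) with hCb
  have hCa0 : 0 ≤ Ca := by positivity
  have hCb0 : 0 ≤ Cb := by positivity
  have hc'c : c' ≤ c := min_le_left _ _
  have hc'r : c' ≤ r₀ / δ := min_le_right _ _
  clear_value Ca Cb c' c ω
  refine ⟨Ca + Cb, add_nonneg hCa0 hCb0, ?_⟩
  intro Ω 𝒯 g Γ hΩ hσ hΓ hΓM hMΓ hmax v hv hv0 hLip T hTcut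
  obtain ⟨hT, x, hxT, hxΓ⟩ := mem_cutElements.1 hTcut
  refine ⟨x, hxT, ?_⟩
  set h := meshSize T with hh
  have hh0 : 0 < h := meshSize_pos hd0 hσ hT
  set I : Finset (Pt d) → ℝ := fun S => ∫ x in simplex S ∩ Γ, v x ^ 2 ∂μHE[d - 1] with hI
  set D : Finset (Pt d) → ℝ := fun S => ∫ x in simplex S, ‖gradient v x‖ ^ 2 with hD
  have hI0 : ∀ S, 0 ≤ I S := fun S => integral_nonneg fun x => sq_nonneg _
  have hD0 : ∀ S, 0 ≤ D S := fun S => integral_nonneg fun x => sq_nonneg _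
  set Q := 𝒯.cutPatch Γ T with hQ
  have hQe : ∀ S ∈ Q, S ∈ 𝒯.elements := fun S hS => mem_elements_of_mem_patch (mem_cutPatch.1 hS).2
  have hsum : ∑ S ∈ Q, ((meshSize S)⁻¹ * I S + D S) =
      ∑ S ∈ Q, (meshSize S)⁻¹ * I S + ∑ S ∈ Q, D S := Finset.sum_add_distrib
  set sI := ∑ S ∈ Q, (meshSize S)⁻¹ * I S with hsI
  set sD := ∑ S ∈ Q, D S with hsD
  have hsI0 : 0 ≤ sI := Finset.sum_nonneg fun S hS =>
    mul_nonneg (inv_nonneg.2 diam_nonneg) (hI0 S)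
  have hsD0 : 0 ≤ sD := Finset.sum_nonneg fun S _ => hD0 S
  clear_value sI sD
  change _ ≤ (Ca + Cb) * ∑ S ∈ Q, ((meshSize S)⁻¹ * I S + D S)
  rw [hsum]
  have hcross : Ca * sD + Cb * sI ≤ (Ca + Cb) * (sI + sD) := by
    nlinarith [mul_nonneg hCa0 hsI0, mul_nonneg hCb0 hsD0]
  refine le_trans ?_ hcross
  have hrhs : 0 ≤ Ca * sD + Cb * sI := add_nonneg (mul_nonneg hCa0 hsD0) (mul_nonneg hCb0 hsI0)
  have hzero : ∀ y ∈ closure Ω, y ∉ Ω → v y = 0 := fun y hy hyΩ =>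
    hv0 y ⟨hy, by rwa [hΩ.interior_eq]⟩
  -- A point of `T ∩ Γ` outside `Ω` lies on `∂Ω`, where `v` vanishes.
  by_cases hxΩ : x ∈ Ω
  swap
  · rw [hzero x (simplex_subset_closure hT hxT) hxΩ]
    simpa using hrhs
  obtain ⟨Φ, hΦ0, hΦM, hΦbil, -⟩ := hch.image g x (hΓM hxΓ) trivial
  set r := min (c * h) r₀ with hr
  have hr0 : 0 < r := lt_min (by positivity) hr₀
  have hrc : c' * h ≤ r := by
    refine le_min (mul_le_mul_of_nonneg_right hc'c hh0.le) ?_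
    calc c' * h ≤ r₀ / δ * δ := mul_le_mul hc'r (hmax T hT) hh0.le (by positivity)
      _ = r₀ := div_mul_cancel₀ _ hδ.ne'
  have hrsub : closedBall (0 : Pt (d - 1)) r ⊆ closedBall 0 r₀ :=
    closedBall_subset_closedBall (min_le_right _ _)
  set G := √(C₁ * K ^ d * (h ^ d)⁻¹ * sD) with hG
  have hG0 : 0 ≤ G := Real.sqrt_nonneg _
  have hGsq : G ^ 2 = C₁ * K ^ d * (h ^ d)⁻¹ * sD := Real.sq_sqrt (by positivity)
  have hscale : h ^ d * (h ^ 2)⁻¹ * (8 * (r * G) ^ 2) ≤ Ca * sD := by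
    have h1 : r ^ 2 ≤ h ^ 2 := by
      refine pow_le_pow_left₀ hr0.le ((min_le_left _ _).trans ?_) 2
      calc c * h ≤ 1 * h := mul_le_mul_of_nonneg_right hc1 hh0.le
        _ = h := one_mul h
    calc h ^ d * (h ^ 2)⁻¹ * (8 * (r * G) ^ 2)
        = 8 * (C₁ * K ^ d) * sD * (r ^ 2 * (h ^ 2)⁻¹) * (h ^ d * (h ^ d)⁻¹) := by
          rw [mul_pow, hGsq]; ring
      _ ≤ 8 * (C₁ * K ^ d) * sD * 1 * 1 := by
          rw [mul_inv_cancel₀ (by positivity)]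
          gcongr
          rw [← div_eq_mul_inv]
          exact div_le_one_of_le₀ h1 (by positivity)
      _ = Ca * sD := by rw [hCa]; ring
  -- paths in the chart
  have hseg : ∀ a ∈ closedBall (0 : Pt (d - 1)) r, ∀ t ∈ Set.Icc (0 : ℝ) 1,
      t • a ∈ closedBall (0 : Pt (d - 1)) r := by
    intro a ha t ht
    rw [mem_closedBall_zero_iff] at ha ⊢
    rw [norm_smul, Real.norm_of_nonneg ht.1]
    nlinarith [ht.1, ht.2, norm_nonneg a]
  have hpathLip : ∀ a ∈ closedBall (0 : Pt (d - 1)) r, ∀ s ∈ Set.Icc (0 : ℝ) 1,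
      ∀ t ∈ Set.Icc (0 : ℝ) 1, dist (Φ (s • a)) (Φ (t • a)) ≤ 2 * r * |s - t| := by
    intro a ha s hs t ht
    refine (hΦbil _ (hrsub (hseg a ha s hs)) _ (hrsub (hseg a ha t ht))).1.trans ?_
    rw [dist_eq_norm, ← sub_smul, norm_smul, Real.norm_eq_abs]
    rw [mem_closedBall_zero_iff] at ha
    nlinarith [abs_nonneg (s - t)]
  have hlen : ∀ b ≤ (1 : ℝ), σ * K * (2 * r * b) < h := by
    intro b hb
    have h1 : r ≤ c * h := min_le_left _ _
    have h2 : σ * K * c = 1 / 4 := by rw [hc]; field_simp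
    have h3 : 2 * r * b ≤ 2 * r := by nlinarith
    calc σ * K * (2 * r * b) ≤ σ * K * (2 * (c * h)) := by
          refine mul_le_mul_of_nonneg_left (h3.trans ?_) (by positivity)
          linarith
      _ = 2 * (σ * K * c) * h := by ring
      _ < h := by rw [h2]; linarith
  have hpath : ∀ a ∈ closedBall (0 : Pt (d - 1)) r, ∀ b : ℝ, 0 < b → b ≤ 1 →
      (∀ t ∈ Set.Ico 0 b, Φ (t • a) ∈ Ω) →
      (∀ t ∈ Set.Icc 0 b, ∃ T' ∈ Q, Φ (t • a) ∈ simplex T') ∧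
        |v (Φ (b • a)) - v x| ≤ 2 * (r * G) := by
    intro a ha b hb0 hb1 hΩt
    have hsub : Set.Icc 0 b ⊆ Set.Icc (0 : ℝ) 1 := Set.Icc_subset_Icc_right hb1
    have h1 := path_estimate (Γ := Γ) hd hσ hσ1 hΩ hT hC₁ hLip (γ := fun t => Φ (t • a))
      (ℓ := 2 * r) hb0 (by positivity)
      (fun s hs t ht => hpathLip a ha s (hsub hs) t (hsub ht))
      (fun t ht => ⟨hΩt t ht, hMΓ ⟨hΦM _ (hrsub (hseg a ha t
        (hsub (Set.Ico_subset_Icc_self ht)))), hΩt t ht⟩⟩)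
      (by simpa [hΦ0] using hxT) (hlen b hb1)
    refine ⟨h1.1, ?_⟩
    have h2 := h1.2
    simp only [zero_smul, hΦ0] at h2
    have h3 : √(C₁ * patchRatio d σ ^ d * (meshSize T ^ d)⁻¹ *
        ∑ S ∈ 𝒯.cutPatch Γ T, ∫ x in simplex S, ‖gradient v x‖ ^ 2) = G := by
      rw [hG, hsD]
    rw [h3] at h2
    refine h2.trans ?_
    have : 0 ≤ G * (2 * r) := by positivity
    nlinarith
  -- Either some ray reaches `∂Ω`, where `v = 0`, or the whole chart image lies in `Γ` and
  -- contributes area of order `h^(d-1)`.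
  by_cases hexit : ∃ a ∈ closedBall (0 : Pt (d - 1)) r, Φ a ∉ Ω
  · obtain ⟨a, ha, haΩ⟩ := hexit
    have hcont : ContinuousOn (fun t : ℝ => Φ (t • a)) (Set.Icc 0 1) := by
      refine (LipschitzOnWith.of_dist_le_mul (K := ⟨2 * r, by positivity⟩)
        fun s hs t ht => ?_).continuousOn
      rw [Real.dist_eq]
      exact hpathLip a ha s hs t ht
    have hcl := hcont.preimage_isClosed_of_isClosed isClosed_Icc hΩ.isClosed_compl
    set Z := Set.Icc (0 : ℝ) 1 ∩ (fun t : ℝ => Φ (t • a)) ⁻¹' Ωᶜ with hZ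
    have hZc : IsCompact Z := isCompact_Icc.of_isClosed_subset hcl Set.inter_subset_left
    have hτ := hZc.sInf_mem ⟨1, by simp, by simpa using haΩ⟩
    set τ := sInf Z with hτdef
    have hτpos : 0 < τ := by
      refine lt_of_le_of_ne hτ.1.1 fun h0 => hτ.2 ?_
      rw [← h0]
      simpa [hΦ0] using hxΩ
    obtain ⟨hcov, hdiff⟩ := hpath a ha τ hτpos hτ.1.2 fun t ht => by
      by_contra hn
      exact absurd (csInf_le hZc.bddBelow
        (show t ∈ Z from ⟨⟨ht.1, ht.2.le.trans hτ.1.2⟩, hn⟩)) (not_le.2 ht.2)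
    obtain ⟨T', hT', hmem⟩ := hcov τ ⟨hτpos.le, le_rfl⟩
    rw [hzero _ (simplex_subset_closure (hQe T' hT') hmem) hτ.2, zero_sub, abs_neg] at hdiff
    have hsq : v x ^ 2 ≤ 8 * (r * G) ^ 2 := by
      rw [← sq_abs]
      nlinarith [abs_nonneg (v x), mul_nonneg hr0.le hG0]
    calc h ^ d * (h ^ 2)⁻¹ * v x ^ 2 ≤ h ^ d * (h ^ 2)⁻¹ * (8 * (r * G) ^ 2) := by gcongr
      _ ≤ Ca * sD := hscale
      _ ≤ Ca * sD + Cb * sI := le_add_of_nonneg_right (mul_nonneg hCb0 hsI0)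
  · push Not at hexit
    have hpt : ∀ a ∈ closedBall (0 : Pt (d - 1)) r, (∃ T' ∈ Q, Φ a ∈ simplex T') ∧
        |v (Φ a) - v x| ≤ 2 * (r * G) := by
      intro a ha
      obtain ⟨h1, h2⟩ := hpath a ha 1 one_pos le_rfl fun t ht =>
        hexit _ (hseg a ha t (Set.Ico_subset_Icc_self ht))
      rw [one_smul] at h2
      exact ⟨by simpa using h1 1 (by simp), h2⟩
    set S₀ := Φ '' closedBall 0 r with hS₀
    have hS₀Γ : S₀ ⊆ Γ := by
      rintro _ ⟨a, ha, rfl⟩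
      exact hMΓ ⟨hΦM a (hrsub ha), hexit a ha⟩
    have hS₀c : IsCompact S₀ := by
      refine (isCompact_closedBall 0 r).image_of_continuousOn ?_
      exact (LipschitzOnWith.of_dist_le_mul (K := 2) fun a ha b hb =>
        (hΦbil a (hrsub ha) b (hrsub hb)).1).continuousOn
    have hTΓfin : ∀ S ∈ 𝒯.elements, μHE[d - 1] (simplex S ∩ Γ) < ⊤ := by
      intro S hS
      rcases (simplex S ∩ Γ).eq_empty_or_nonempty with he | ⟨y, hyS, hyΓ⟩
      · simp [he]
      · have hsub : simplex S ∩ Γ ⊆ g '' M ∩ closedBall y (meshSize S) := fun w hw =>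
          ⟨hΓM hw.2, dist_le_meshSize hw.1 hyS⟩
        exact (measure_mono hsub).trans_lt
          ((hmeas g y (hΓM hyΓ) (meshSize S) diam_nonneg).trans_lt ENNReal.ofReal_lt_top)
    have hAfin : ∀ S ∈ Q, μHE[d - 1] (simplex S ∩ S₀) < ⊤ := fun S hS =>
      (measure_mono (Set.inter_subset_inter_right _ hS₀Γ)).trans_lt (hTΓfin S (hQe S hS))
    have harea : r ^ (d - 1) * ω ≤
        2 ^ (d - 1) * ∑ S ∈ Q, (μHE[d - 1] : Measure (Pt d)).real (simplex S ∩ S₀) := by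
      have h1 := le_measure_image_closedBall hr0.le fun a ha b hb =>
        (hΦbil a (hrsub ha) b (hrsub hb)).2
      have h2 : μHE[d - 1] S₀ ≤ ∑ S ∈ Q, μHE[d - 1] (simplex S ∩ S₀) := by
        refine (measure_mono ?_).trans (measure_biUnion_finset_le Q fun S => simplex S ∩ S₀)
        rintro _ ⟨a, ha, rfl⟩
        obtain ⟨T', hT', hmem⟩ := (hpt a ha).1
        exact Set.mem_biUnion hT' ⟨hmem, a, ha, rfl⟩
      have h3 : ∑ S ∈ Q, μHE[d - 1] (simplex S ∩ S₀) =
          ENNReal.ofReal (∑ S ∈ Q, (μHE[d - 1] : Measure (Pt d)).real (simplex S ∩ S₀)) := by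
        rw [ENNReal.ofReal_sum_of_nonneg fun S _ => measureReal_nonneg]
        exact Finset.sum_congr rfl fun S hS => (ofReal_measureReal (hAfin S hS).ne).symm
      have h4 := h1.trans (mul_le_mul_right (h2.trans_eq h3) (2 ^ (d - 1)))
      have h5 : (2 : ENNReal) ^ (d - 1) = ENNReal.ofReal (2 ^ (d - 1)) := by
        rw [ENNReal.ofReal_pow (by norm_num)]
        simp
      rw [h5, ← ENNReal.ofReal_mul (by positivity),
        ENNReal.ofReal_le_ofReal_iff (mul_nonneg (by positivity)
          (Finset.sum_nonneg fun S _ => measureReal_nonneg))] at h4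
      rwa [hω]
    -- A lower bound for `v²` on the chart image, from `v(x)² ≤ 2 v(y)² + 2 (v(y) - v(x))²`. It may
    -- be negative, in which case the bound for `W` is trivial.
    set W := v x ^ 2 / 2 - (2 * (r * G)) ^ 2 with hW
    have hWI : ∀ S ∈ Q, W * (μHE[d - 1] : Measure (Pt d)).real (simplex S ∩ S₀) ≤ I S := by
      intro S hS
      have hSm : MeasurableSet (simplex S) := (isCompact_simplex S).isClosed.measurableSet
      have hAm : MeasurableSet (simplex S ∩ S₀) := hSm.inter hS₀c.isClosed.measurableSet
      have hle : ∀ y ∈ simplex S ∩ S₀, W ≤ v y ^ 2 := by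
        rintro _ ⟨-, a, ha, rfl⟩
        have h1 := (hpt a ha).2
        have h2 : (v (Φ a) - v x) ^ 2 ≤ (2 * (r * G)) ^ 2 := by
          rw [← sq_abs]
          exact pow_le_pow_left₀ (abs_nonneg _) h1 2
        rw [hW]
        nlinarith [sq_nonneg (2 * v (Φ a) - v x)]
      have h1 := setIntegral_ge_of_const_le_real hAm (hAfin S hS).ne hle
        (integrableOn_sq_of_subset (hv S (hQe S hS)) hAm Set.inter_subset_left (hAfin S hS))
      refine h1.trans (setIntegral_mono_set (integrableOn_sq_of_subset (hv S (hQe S hS))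
        (hSm.inter hΓ.measurableSet) Set.inter_subset_left (hTΓfin S (hQe S hS)))
        (Filter.Eventually.of_forall fun y => sq_nonneg _)
        (LE.le.eventuallyLE (Set.inter_subset_inter_right _ hS₀Γ)))
    have hWbound : h ^ d * (h ^ 2)⁻¹ * (2 * W) ≤ Cb * sI := by
      rcases le_total W 0 with hW0 | hW0
      · have : h ^ d * (h ^ 2)⁻¹ * (2 * W) ≤ 0 :=
          mul_nonpos_of_nonneg_of_nonpos (by positivity) (by linarith)
        exact this.trans (mul_nonneg hCb0 hsI0)
      have h1 : W * (r ^ (d - 1) * ω) ≤ 2 ^ (d - 1) * ∑ S ∈ Q, I S := by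
        calc W * (r ^ (d - 1) * ω) ≤ W * (2 ^ (d - 1) *
              ∑ S ∈ Q, (μHE[d - 1] : Measure (Pt d)).real (simplex S ∩ S₀)) := by gcongr
          _ = 2 ^ (d - 1) * ∑ S ∈ Q,
              W * (μHE[d - 1] : Measure (Pt d)).real (simplex S ∩ S₀) := by
              rw [Finset.mul_sum, Finset.mul_sum, Finset.mul_sum]
              exact Finset.sum_congr rfl fun S _ => by ring
          _ ≤ _ := by
              refine mul_le_mul_of_nonneg_left (Finset.sum_le_sum hWI) (by positivity)
      have h2 : W * ((c' * h) ^ (d - 1) * ω) ≤ 2 ^ (d - 1) * ∑ S ∈ Q, I S := by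
        refine le_trans ?_ h1
        gcongr
      have h3 : h⁻¹ * ∑ S ∈ Q, I S ≤ K * sI := by
        rw [Finset.mul_sum, hsI, Finset.mul_sum]
        refine Finset.sum_le_sum fun S hS => ?_
        rw [← mul_assoc]
        refine mul_le_mul_of_nonneg_right ?_ (hI0 S)
        have hS0 := meshSize_pos hd0 hσ (hQe S hS)
        rw [← div_eq_mul_inv, inv_eq_one_div, div_le_div_iff₀ hh0 hS0, one_mul]
        exact (meshSize_patch hd hσ hσ1 hΩ hT (mem_cutPatch.1 hS).2).1
      have hhd : h ^ d = h ^ (d - 1) * h := by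
        rw [← pow_succ]; congr 1; omega
      calc h ^ d * (h ^ 2)⁻¹ * (2 * W)
          = 2 * h⁻¹ * (W * ((c' * h) ^ (d - 1) * ω)) / (c' ^ (d - 1) * ω) := by
            rw [hhd, mul_pow]; field_simp
        _ ≤ 2 * h⁻¹ * (2 ^ (d - 1) * ∑ S ∈ Q, I S) / (c' ^ (d - 1) * ω) := by gcongr
        _ = 2 * (2 ^ (d - 1) / (c' ^ (d - 1) * ω)) * (h⁻¹ * ∑ S ∈ Q, I S) := by ring
        _ ≤ 2 * (2 ^ (d - 1) / (c' ^ (d - 1) * ω)) * (K * sI) := by gcongr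
        _ = Cb * sI := by rw [hCb]; ring
    calc h ^ d * (h ^ 2)⁻¹ * v x ^ 2
        = h ^ d * (h ^ 2)⁻¹ * (8 * (r * G) ^ 2) + h ^ d * (h ^ 2)⁻¹ * (2 * W) := by
          rw [hW]; ring
      _ ≤ Ca * sD + Cb * sI := add_le_add hscale hWbound

/-! ### Summation over the cut elements and the norm equivalence. -/

theorem IsShapeRegular.mono {τ : ℝ} (h : 𝒯.IsShapeRegular σ) (hστ : σ ≤ τ) :
    𝒯.IsShapeRegular τ := fun T hT => by
  obtain ⟨z, ρ, hρ, hb, hm⟩ := h T hT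
  exact ⟨z, ρ, hρ, hb, hm.trans (mul_le_mul_of_nonneg_right hστ hρ.le)⟩

theorem meshSize_le_diam {T : Finset (Pt d)} (hT : T ∈ 𝒯.elements) :
    meshSize T ≤ diam (closure Ω) := by
  refine diam_mono (simplex_subset_closure hT) ?_
  rw [closure_eq (𝒯 := 𝒯)]
  exact (𝒯.elements.finite_toSet.isCompact_biUnion fun S _ => isCompact_simplex S).isBounded

/-- Finite overlap: touching is symmetric, so the `T` whose patch contains `S` are among the
boundedly many elements touching `S`. -/
theorem sum_sum_cutPatch_le (hd : 0 < d) (hσ : 𝒯.IsShapeRegular σ) (hσ1 : 1 ≤ σ)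
    (Γ : Set (Pt d)) {w : Finset (Pt d) → ℝ} (hw : ∀ S, 0 ≤ w S) :
    ∑ T ∈ 𝒯.cutElements Γ, ∑ S ∈ 𝒯.cutPatch Γ T, w S ≤
      touchingBound d σ * ∑ S ∈ 𝒯.cutElements Γ, w S := by
  classical
  simp_rw [cutPatch, Finset.sum_filter]
  rw [Finset.sum_comm, Finset.mul_sum]
  refine Finset.sum_le_sum fun S hS => ?_
  rw [← Finset.sum_filter, Finset.sum_const, nsmul_eq_mul]
  refine mul_le_mul_of_nonneg_right ?_ (hw S)
  have hSe := (mem_cutElements.1 hS).1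
  refine le_trans ?_ (Nat.cast_le.2 (card_touching_le hd hσ hσ1 hSe))
  refine Nat.cast_le.2 (Finset.card_le_card fun T hT => ?_)
  obtain ⟨hTc, hST⟩ := Finset.mem_filter.1 hT
  obtain ⟨-, p, hp, hp'⟩ := mem_touching.1 (patch_subset_touching T hST)
  exact mem_touching.2 ⟨(mem_cutElements.1 hTc).1, p, hp', hp⟩

/-- Poincaré inequality on an element in terms of one point value. -/
theorem scaled_norm_sq_le {T : Finset (Pt d)} {v : Pt d → ℝ} {C : ℝ} (hC : 0 ≤ C)
    (hT0 : 0 < meshSize T)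
    (hLip : ∀ x ∈ simplex T, ∀ y ∈ simplex T, |v x - v y| ≤
      √(C * (meshSize T ^ d)⁻¹ * ∫ x in simplex T, ‖gradient v x‖ ^ 2) * dist x y)
    (hvol : volume.real (simplex T) ≤ C * meshSize T ^ d) {x : Pt d} (hx : x ∈ simplex T) :
    (meshSize T ^ 2)⁻¹ * ∫ y in simplex T, v y ^ 2 ≤
      2 * C * (meshSize T ^ d * (meshSize T ^ 2)⁻¹ * v x ^ 2) +
        2 * C ^ 2 * ∫ y in simplex T, ‖gradient v y‖ ^ 2 := by
  set D := ∫ y in simplex T, ‖gradient v y‖ ^ 2 with hD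
  have hD0 : 0 ≤ D := integral_nonneg fun x => sq_nonneg _
  clear_value D
  set h := meshSize T
  have hpt : ∀ y ∈ simplex T, ‖v y ^ 2‖ ≤ 2 * v x ^ 2 + 2 * (C * (h ^ d)⁻¹ * D * h ^ 2) := by
    intro y hy
    rw [Real.norm_of_nonneg (sq_nonneg _)]
    have h1 : |v y - v x| ≤ √(C * (h ^ d)⁻¹ * D) * h := (hLip y hy x hx).trans
      (mul_le_mul_of_nonneg_left (dist_le_meshSize hy hx) (Real.sqrt_nonneg _))
    have h2 : (v y - v x) ^ 2 ≤ C * (h ^ d)⁻¹ * D * h ^ 2 := by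
      rw [← sq_abs]
      refine (pow_le_pow_left₀ (abs_nonneg _) h1 2).trans_eq ?_
      rw [mul_pow, Real.sq_sqrt (by positivity)]
    nlinarith [sq_nonneg (v y - 2 * v x)]
  have h3 := norm_setIntegral_le_of_norm_le_const
    (isCompact_simplex T).measure_lt_top (μ := volume) hpt
  have h4 : ∫ y in simplex T, v y ^ 2 ≤
      (2 * v x ^ 2 + 2 * (C * (h ^ d)⁻¹ * D * h ^ 2)) * (C * h ^ d) :=
    (le_abs_self _).trans (h3.trans (mul_le_mul_of_nonneg_left hvol (by positivity)))
  calc (h ^ 2)⁻¹ * ∫ y in simplex T, v y ^ 2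
      ≤ (h ^ 2)⁻¹ * ((2 * v x ^ 2 + 2 * (C * (h ^ d)⁻¹ * D * h ^ 2)) * (C * h ^ d)) := by gcongr
    _ = _ := by field_simp

theorem scaled_interface_norm_sq_le {T : Finset (Pt d)} {Γ S : Set (Pt d)} {v : Pt d → ℝ}
    {C CM : ℝ} (hd : 0 < d) (hC : 0 ≤ C) (hCM : 0 ≤ CM) (hT0 : 0 < meshSize T)
    (hsup : ∀ y ∈ simplex T, v y ^ 2 ≤ C * (meshSize T ^ d)⁻¹ * ∫ x in simplex T, v x ^ 2)
    (hΓS : Γ ⊆ S) (hmeas : ∀ x ∈ S, ∀ r : ℝ, 0 ≤ r →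
      μHE[d - 1] (S ∩ closedBall x r) ≤ ENNReal.ofReal (CM * r ^ (d - 1))) :
    (meshSize T)⁻¹ * ∫ x in simplex T ∩ Γ, v x ^ 2 ∂μHE[d - 1] ≤
      C * CM * ((meshSize T ^ 2)⁻¹ * ∫ x in simplex T, v x ^ 2) := by
  set E := ∫ x in simplex T, v x ^ 2 with hE
  have hE0 : 0 ≤ E := integral_nonneg fun x => sq_nonneg _
  clear_value E
  set h := meshSize T with hh
  have hle : μHE[d - 1] (simplex T ∩ Γ) ≤ ENNReal.ofReal (CM * h ^ (d - 1)) := by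
    rcases (simplex T ∩ Γ).eq_empty_or_nonempty with he | ⟨x, hxT, hxΓ⟩
    · simp [he]
    · have hsub : simplex T ∩ Γ ⊆ S ∩ closedBall x h := fun w hw =>
        ⟨hΓS hw.2, dist_le_meshSize hw.1 hxT⟩
      exact (measure_mono hsub).trans (hmeas x (hΓS hxΓ) h hT0.le)
  have hreal : (μHE[d - 1] : Measure (Pt d)).real (simplex T ∩ Γ) ≤ CM * h ^ (d - 1) :=
    ENNReal.toReal_le_of_le_ofReal (by positivity) hle
  have h1 := norm_setIntegral_le_of_norm_le_const (f := fun x => v x ^ 2)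
    (C := C * (h ^ d)⁻¹ * E) (hle.trans_lt ENNReal.ofReal_lt_top) fun y hy => by
      rw [Real.norm_of_nonneg (sq_nonneg _)]
      exact hsup y hy.1
  have h2 : ∫ x in simplex T ∩ Γ, v x ^ 2 ∂μHE[d - 1] ≤
      C * (h ^ d)⁻¹ * E * (CM * h ^ (d - 1)) :=
    (le_abs_self _).trans (h1.trans (mul_le_mul_of_nonneg_left hreal (by positivity)))
  have hhd : h ^ d = h ^ (d - 1) * h := by
    rw [← pow_succ]; congr 1; omega
  calc h⁻¹ * ∫ x in simplex T ∩ Γ, v x ^ 2 ∂μHE[d - 1]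
      ≤ h⁻¹ * (C * (h ^ d)⁻¹ * E * (CM * h ^ (d - 1))) := by gcongr
    _ = C * CM * ((h ^ 2)⁻¹ * E) := by rw [hhd]; field_simp

/-- Norm equivalence on the strip of cut elements in any dimension at least two. -/
theorem exists_strip_norm_equivalence (hd : 2 ≤ d) (k : ℕ) (σ : ℝ) (Ω : Set (Pt d))
    (hΩ : IsOpen Ω) (M : Set (Pt d)) (hM : IsCompactC1Hypersurface M) :
    ∃ C : ℝ, 0 < C ∧ ∀ (g : Pt d ≃ᵃⁱ[ℝ] Pt d) (Γ : Set (Pt d)), IsClosed Γ → Γ ⊆ g '' M →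
      g '' M ∩ Ω ⊆ Γ → ∀ 𝒯 : Triangulation Ω, 𝒯.IsShapeRegular σ → ∀ v ∈ 𝒯.feSpace k,
        𝒯.scaledStripNormSq Γ v ≤
            C * (𝒯.scaledInterfaceNormSq Γ v + 𝒯.gradStripNormSq Γ v) ∧
          𝒯.scaledInterfaceNormSq Γ v + 𝒯.gradStripNormSq Γ v ≤
            C * 𝒯.scaledStripNormSq Γ v := by
  have hd0 : 0 < d := by omega
  -- The preceding estimates assume a parameter at least `1`; shape regularity is preserved when it
  -- increases.
  set τ := max σ 1 with hτ
  have hτ1 : 1 ≤ τ := le_max_right _ _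
  obtain ⟨C₁, hC₁, hest⟩ := exists_element_estimates hd0 k hτ1
  obtain ⟨C₂, hC₂, hloc⟩ := exists_local_estimate hd k hτ1 hM hC₁
    (δ := Metric.diam (closure Ω) + 1) (by have := Metric.diam_nonneg (s := closure Ω); linarith)
  obtain ⟨CM, hCM, hmeas⟩ := exists_measure_inter_closedBall_le hM
  set C₃ := 2 * C₁ * C₂ + 2 * C₁ ^ 2 with hC₃
  have hC₃0 : 0 ≤ C₃ := by positivity
  set N : ℝ := ((touchingBound d τ : ℕ) : ℝ) with hN
  have hN0 : 0 ≤ N := Nat.cast_nonneg _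
  -- `C₃ * N` serves the lower bound, with `N` the overlap, and `C₁ * CM + C₁` the upper bound; the
  -- `1` ensures positivity.
  refine ⟨C₃ * N + (C₁ * CM + C₁) + 1, by positivity, ?_⟩
  intro g Γ hΓcl hΓM hMΓ 𝒯 hσ v hv
  have hreg : 𝒯.IsShapeRegular τ := hσ.mono (le_max_left _ _)
  obtain ⟨-, hpoly, hzero⟩ := hv
  have hcut : ∀ T ∈ 𝒯.cutElements Γ, T ∈ 𝒯.elements := fun T hT => (mem_cutElements.1 hT).1
  have hE : ∀ T ∈ 𝒯.elements, _ := fun T hT => hest Ω 𝒯 hreg T hT v (hpoly T hT)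
  set a : Finset (Pt d) → ℝ := fun T => (meshSize T ^ 2)⁻¹ * ∫ x in simplex T, v x ^ 2 with ha
  set b : Finset (Pt d) → ℝ := fun T =>
    (meshSize T)⁻¹ * ∫ x in simplex T ∩ Γ, v x ^ 2 ∂μHE[d - 1] with hb
  set D : Finset (Pt d) → ℝ := fun T => ∫ x in simplex T, ‖gradient v x‖ ^ 2 with hD
  have ha0 : ∀ T, 0 ≤ a T := fun T =>
    mul_nonneg (inv_nonneg.2 (sq_nonneg _)) (integral_nonneg fun x => sq_nonneg _)
  have hb0 : ∀ T, 0 ≤ b T := fun T =>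
    mul_nonneg (inv_nonneg.2 Metric.diam_nonneg) (integral_nonneg fun x => sq_nonneg _)
  have hD0 : ∀ T, 0 ≤ D T := fun T => integral_nonneg fun x => sq_nonneg _
  have hstrip : 𝒯.scaledStripNormSq Γ v = ∑ T ∈ 𝒯.cutElements Γ, a T := rfl
  have hright : 𝒯.scaledInterfaceNormSq Γ v + 𝒯.gradStripNormSq Γ v =
      ∑ T ∈ 𝒯.cutElements Γ, (b T + D T) := by
    rw [gradStripNormSq_eq hpoly, Finset.sum_add_distrib]
    rfl
  have hw0 : ∀ T, 0 ≤ b T + D T := fun T => add_nonneg (hb0 T) (hD0 T)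
  rw [hstrip, hright]
  have hA0 : 0 ≤ ∑ T ∈ 𝒯.cutElements Γ, a T := Finset.sum_nonneg fun T _ => ha0 T
  have hB0 : 0 ≤ ∑ T ∈ 𝒯.cutElements Γ, (b T + D T) := Finset.sum_nonneg fun T _ => hw0 T
  have hCM1 : 0 ≤ C₁ * CM + C₁ := by positivity
  have hCN : 0 ≤ C₃ * N := mul_nonneg hC₃0 hN0
  constructor
  · have hlower : ∀ T ∈ 𝒯.cutElements Γ, a T ≤ C₃ * ∑ S ∈ 𝒯.cutPatch Γ T, (b S + D S) := by
      intro T hT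
      have hTe := hcut T hT
      obtain ⟨x, hxT, hx⟩ := hloc Ω 𝒯 g Γ hΩ hreg hΓcl hΓM hMΓ
        (fun S hS => (meshSize_le_diam hS).trans (by linarith)) v hpoly hzero
        (fun S hS => (hE S hS).2.2.1) T hT
      have h1 := scaled_norm_sq_le hC₁ (meshSize_pos hd0 hreg hTe) (hE T hTe).2.2.1
        (hE T hTe).2.2.2 hxT
      have h2 : D T ≤ ∑ S ∈ 𝒯.cutPatch Γ T, (b S + D S) :=
        (le_add_of_nonneg_left (hb0 T)).trans (Finset.single_le_sum (f := fun S => b S + D S)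
          (fun S _ => hw0 S) (mem_cutPatch.2 ⟨hT, self_mem_patch hTe⟩))
      have h3 : 2 * C₁ * (meshSize T ^ d * (meshSize T ^ 2)⁻¹ * v x ^ 2) ≤
          2 * C₁ * (C₂ * ∑ S ∈ 𝒯.cutPatch Γ T, (b S + D S)) :=
        mul_le_mul_of_nonneg_left hx (by positivity)
      have h4 : 2 * C₁ ^ 2 * D T ≤ 2 * C₁ ^ 2 * ∑ S ∈ 𝒯.cutPatch Γ T, (b S + D S) :=
        mul_le_mul_of_nonneg_left h2 (by positivity)
      refine h1.trans ((add_le_add h3 h4).trans_eq ?_)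
      rw [hC₃]
      ring
    calc ∑ T ∈ 𝒯.cutElements Γ, a T
        ≤ ∑ T ∈ 𝒯.cutElements Γ, C₃ * ∑ S ∈ 𝒯.cutPatch Γ T, (b S + D S) :=
          Finset.sum_le_sum hlower
      _ = C₃ * ∑ T ∈ 𝒯.cutElements Γ, ∑ S ∈ 𝒯.cutPatch Γ T, (b S + D S) := by
          rw [Finset.mul_sum]
      _ ≤ C₃ * (N * ∑ T ∈ 𝒯.cutElements Γ, (b T + D T)) :=
          mul_le_mul_of_nonneg_left (sum_sum_cutPatch_le hd0 hreg hτ1 Γ hw0) hC₃0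
      _ = C₃ * N * ∑ T ∈ 𝒯.cutElements Γ, (b T + D T) := by ring
      _ ≤ _ := mul_le_mul_of_nonneg_right (by linarith) hB0
  · have hupper : ∀ T ∈ 𝒯.cutElements Γ, b T + D T ≤ (C₁ * CM + C₁) * a T := by
      intro T hT
      have hTe := hcut T hT
      have h1 : b T ≤ C₁ * CM * a T := scaled_interface_norm_sq_le hd0 hC₁ hCM
        (meshSize_pos hd0 hreg hTe) (hE T hTe).1 hΓM (hmeas g)
      have h2 : D T ≤ C₁ * a T := (hE T hTe).2.1.trans_eq (by rw [ha]; ring)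
      linarith
    calc ∑ T ∈ 𝒯.cutElements Γ, (b T + D T)
        ≤ ∑ T ∈ 𝒯.cutElements Γ, (C₁ * CM + C₁) * a T := Finset.sum_le_sum hupper
      _ = (C₁ * CM + C₁) * ∑ T ∈ 𝒯.cutElements Γ, a T := by rw [Finset.mul_sum]
      _ ≤ _ := mul_le_mul_of_nonneg_right (by linarith) hA0

end Triangulation

end CutFEM

theorem mainTheorem4 {d : ℕ} (hd : d = 2 ∨ d = 3) (k : ℕ) (hk : 1 ≤ k) (σ : ℝ)
    (Ω : Set (CutFEM.Pt d)) (hΩ : CutFEM.IsPolygonalDomain Ω)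
    (M : Set (CutFEM.Pt d)) (hM : CutFEM.IsCompactC1Hypersurface M) :
    ∃ C : ℝ, 0 < C ∧
      ∀ (g : CutFEM.Pt d ≃ᵃⁱ[ℝ] CutFEM.Pt d) (Ω₁ Ω₂ : Set (CutFEM.Pt d)),
        CutFEM.IsPartition Ω Ω₁ Ω₂ →
        CutFEM.interface Ω₁ Ω₂ ⊆ g '' M →
        g '' M ∩ Ω ⊆ CutFEM.interface Ω₁ Ω₂ →
        ∀ 𝒯 : CutFEM.Triangulation Ω, 𝒯.IsShapeRegular σ →
          ∀ v ∈ 𝒯.feSpace k,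
            𝒯.scaledStripNormSq (CutFEM.interface Ω₁ Ω₂) v ≤
                C * (𝒯.scaledInterfaceNormSq (CutFEM.interface Ω₁ Ω₂) v +
                  𝒯.gradStripNormSq (CutFEM.interface Ω₁ Ω₂) v) ∧
              𝒯.scaledInterfaceNormSq (CutFEM.interface Ω₁ Ω₂) v +
                  𝒯.gradStripNormSq (CutFEM.interface Ω₁ Ω₂) v ≤
                C * 𝒯.scaledStripNormSq (CutFEM.interface Ω₁ Ω₂) v := by
  obtain ⟨C, hC, h⟩ := CutFEM.Triangulation.exists_strip_norm_equivalence (by omega) k σ Ω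
    hΩ.isOpen M hM
  exact ⟨C, hC, fun g Ω₁ Ω₂ _ h₁ h₂ => h g (CutFEM.interface Ω₁ Ω₂)
    (isClosed_closure.inter isClosed_closure) h₁ h₂⟩
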